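/- Let $1\le p,\theta\le\infty$, $r>\max\{1/p,1/2\}$ (with $1/\infty=0$), and fix an integer $k>r$. Consider $2\pi$-periodic functions $f:\mathbb R\to\mathbb C$, with $\|f\|_p=\big(\frac1{2\pi}\int_0^{2\pi}|f(x)|^p\,dx\big)^{1/p}$ for $p<\infty$ and $\|f\|_\infty=\operatorname{ess\,sup}|f|$. Let $\Delta_hf(x)=f(x+h)-f(x)$, let $\Delta_h^k$ be its $k$-th iterate, and put $\omega_k(f,t)_p=\sup_{|h|\le t}\|\Delta_h^kf\|_p$ for $t>0$. The Nikol'skii–Besov class $B^r_{p,\theta}$ is the set of all $f\in L_p$ with $\|f\|_{B^r_{p,\theta}}\le 1$, where $$\|f\|_{B^r_{p,\theta}}=\|f\|_p+\Big(\int_0^\infty\big(t^{-r}\omega_k(f,t)_p\big)^\theta\frac{dt}{t}\Big)^{1/\theta}\quad(\theta<\infty),\qquad \|f\|_{B^r_{p,\infty}}=\|f\|_p+\sup_{t>0}t^{-r}\omega_k(f,t)_p .$$ Let $D_j(x)=\sum_{n=-j}^{j}e^{inx}$, $V_l=\frac1l\sum_{j=l}^{2l-1}D_j$, $V_l(f,x)=\frac1{2\pi}\int_0^{2\pi}f(t)V_l(x-t)\,dt$,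 $\sigma_0(f)=V_1(f)$ and $\sigma_s(f)=V_{2^s}(f)-V_{2^{s-1}}(f)$ for $s\ge1$. Let $B_{\infty,1}$ be the space of all $f\in L_\infty$ for which $\|f\|_{B_{\infty,1}}=\sum_{s=0}^\infty\|\sigma_s(f)\|_\infty$ is finite. For $m\in\mathbb N$ and a set $F\subset B_{\infty,1}$ put $$e_m(F)_{B_{\infty,1}}=\sup_{f\in F}\ \inf_{\Theta\subset\mathbb Z,\ |\Theta|=m}\ \inf_{(c_n)_{n\in\Theta}\subset\mathbb C}\Big\|f-\sum_{n\in\Theta}c_ne^{inx}\Big\|_{B_{\infty,1}} .$$ Then $B^r_{p,\theta}\subset B_{\infty,1}$, and there are constants $C_1,C_2>0$, depending only on $p,\theta,r,k$, such that for all integers $m\ge1$ $$C_1\,m^{-r+(\frac1p-\frac12)_+}\le e_m(B^r_{p,\theta})_{B_{\infty,1}}\le C_2\,m^{-r+(\frac1p-\frac12)_+},\qquad a_+=\max\{a,0\}.$$ -/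

import Mathlib

open MeasureTheory
open scoped ENNReal

noncomputable section

namespace TrigApprox

instance factTwoPiPos : Fact (0 < 2 * Real.pi) := ⟨Real.two_pi_pos⟩

/-- The circle `ℝ / 2πℤ`; functions on it are the `2π`-periodic functions of one variable.
`fourier n : C(Torus, ℂ)` is `x ↦ exp (i n x)`. -/
abbrev Torus : Type := AddCircle (2 * Real.pi)

/-- The norm of `L_p` with respect to the normalised measure `dx / 2π`
(essential supremum for `p = ∞`). -/
def torusNorm (p : ℝ≥0∞) (f : Torus → ℂ) : ℝ≥0∞ :=
  eLpNorm f p AddCircle.haarAddCircle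

/-- `f` belongs to `L_p`. -/
def InLp (p : ℝ≥0∞) (f : Torus → ℂ) : Prop :=
  MemLp f p AddCircle.haarAddCircle

/-- The difference of order `k` with step `h`: the `k`-th iterate of
`Δ_h f (x) = f (x + h) - f x`. -/
def diffOp (k : ℕ) (h : ℝ) (f : Torus → ℂ) : Torus → ℂ :=
  (fun (g : Torus → ℂ) (x : Torus) => g (x + (h : Torus)) - g x)^[k] f

/-- The modulus of smoothness `ω_k(f, t)_p = sup_{|h| ≤ t} ‖Δ_h^k f‖_p`. -/
def modulus (k : ℕ) (p : ℝ≥0∞) (f : Torus → ℂ) (t : ℝ) : ℝ≥0∞ :=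
  ⨆ (h : ℝ) (_ : |h| ≤ t), torusNorm p (diffOp k h f)

/-- `(∫_0^∞ (t^{-r} ω_k(f,t)_p)^θ dt/t)^{1/θ}`, and `sup_{t>0} t^{-r} ω_k(f,t)_p` for `θ = ∞`. -/
def besovSeminorm (k : ℕ) (r : ℝ) (p θ : ℝ≥0∞) (f : Torus → ℂ) : ℝ≥0∞ :=
  if θ = ∞ then
    ⨆ (t : ℝ) (_ : 0 < t), ENNReal.ofReal (t ^ (-r)) * modulus k p f t
  else
    (∫⁻ t in Set.Ioi (0 : ℝ),
      (ENNReal.ofReal (t ^ (-r)) * modulus k p f t) ^ θ.toReal * ENNReal.ofReal (1 / t))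
        ^ (1 / θ.toReal)

/-- The norm of the Nikol'skii-Besov space (computed with differences of order `k > r`). -/
def besovNorm (k : ℕ) (r : ℝ) (p θ : ℝ≥0∞) (f : Torus → ℂ) : ℝ≥0∞ :=
  torusNorm p f + besovSeminorm k r p θ f

/-- The Nikol'skii-Besov class `B^r_{p,θ}`: the unit ball of the space. -/
def besovClass (k : ℕ) (r : ℝ) (p θ : ℝ≥0∞) : Set (Torus → ℂ) :=
  {f | InLp p f ∧ besovNorm k r p θ f ≤ 1}

/-- The Dirichlet kernel `D_k(x) = ∑_{m=-k}^k exp (i m x)`. -/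
def dirichletKernel (k : ℕ) (x : Torus) : ℂ :=
  ∑ m ∈ Finset.Icc (-(k : ℤ)) (k : ℤ), fourier m x

/-- The de la Vallée-Poussin kernel `V_l = l⁻¹ ∑_{k=l}^{2l-1} D_k` (used for `l ≥ 1`). -/
def vpKernel (l : ℕ) (x : Torus) : ℂ :=
  (l : ℂ)⁻¹ * ∑ k ∈ Finset.Icc l (2 * l - 1), dirichletKernel k x

/-- The convolution `V_l(f, x) = (2π)⁻¹ ∫ f(t) V_l(x - t) dt`. -/
def vpSum (l : ℕ) (f : Torus → ℂ) (x : Torus) : ℂ :=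
  ∫ t, f t * vpKernel l (x - t) ∂AddCircle.haarAddCircle

/-- The dyadic blocks `σ_0(f) = V_1(f)` and `σ_s(f) = V_{2^s}(f) - V_{2^{s-1}}(f)`, `s ≥ 1`. -/
def sigmaBlock : ℕ → (Torus → ℂ) → Torus → ℂ
  | 0, f => vpSum 1 f
  | s + 1, f => fun x => vpSum (2 ^ (s + 1)) f x - vpSum (2 ^ s) f x

/-- The norm `‖f‖_{B_{q,1}} = ∑_{s ≥ 0} ‖σ_s(f)‖_q`. -/
def bqOneNorm (q : ℝ≥0∞) (f : Torus → ℂ) : ℝ≥0∞ :=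
  ∑' s : ℕ, torusNorm q (sigmaBlock s f)

/-- The space `B_{q,1}`: the functions of `L_q` for which the series of norms converges. -/
def bqOneSpace (q : ℝ≥0∞) : Set (Torus → ℂ) :=
  {f | InLp q f ∧ bqOneNorm q f < ∞}

/-- The trigonometric polynomial `∑_{n ∈ Θ} c_n exp (i n x)`. -/
def trigPoly (Θ : Finset ℤ) (c : ℤ → ℂ) (x : Torus) : ℂ :=
  ∑ n ∈ Θ, c n * fourier n x

/-- The best `m`-term trigonometric approximation of `f` in the norm `N`. -/
def bestMTerm (N : (Torus → ℂ) → ℝ≥0∞) (m : ℕ) (f : Torus → ℂ) : ℝ≥0∞ :=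
  ⨅ (Θ : Finset ℤ) (_ : Θ.card = m) (c : ℤ → ℂ), N (fun x => f x - trigPoly Θ c x)

/-- The best `m`-term trigonometric approximation of the class `F` in the norm `N`. -/
def bestMTermClass (N : (Torus → ℂ) → ℝ≥0∞) (m : ℕ) (F : Set (Torus → ℂ)) : ℝ≥0∞ :=
  ⨆ f ∈ F, bestMTerm N m f

end TrigApprox

end

noncomputable section

namespace TrigApprox

section Sparse

/-- A subspace of dimension `d` contains a unit vector at which a weighted sum of squares of linear
functionals is at most its average. -/
lemma exists_unit_weighted_sq_le {E κ : Type*} [NormedAddCommGroup E] [InnerProductSpace ℝ E]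
    [FiniteDimensional ℝ E] [Fintype κ] (W : Submodule ℝ E) (w : κ → ℝ) (hw : ∀ j, 0 ≤ w j)
    (u : κ → E) (R : ℝ) (hu : ∀ j, ‖u j‖ ^ 2 ≤ R) (hW : 0 < Module.finrank ℝ W) :
    ∃ y ∈ W, ‖y‖ = 1 ∧
      Module.finrank ℝ W * ∑ j, w j * (inner ℝ (u j) y) ^ 2 ≤ R * ∑ j, w j := by
  set d := Module.finrank ℝ W
  let e := stdOrthonormalBasis ℝ W
  have he : Orthonormal ℝ (fun i => (e i : E)) := e.orthonormal.comp_linearIsometry W.subtypeₗᵢ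
  have hsum : ∑ i, ∑ j, w j * (inner ℝ (u j) (e i : E)) ^ 2 ≤ ∑ _i : Fin d, R * (∑ j, w j) / d := by
    rw [Finset.sum_comm, Finset.sum_const, Finset.card_univ, Fintype.card_fin, nsmul_eq_mul]
    have hd : (d : ℝ) ≠ 0 := by exact_mod_cast hW.ne'
    rw [mul_div_cancel₀ _ hd, Finset.mul_sum]
    refine Finset.sum_le_sum fun j _ => ?_
    rw [← Finset.mul_sum, mul_comm R]
    refine mul_le_mul_of_nonneg_left ?_ (hw j)
    have := he.sum_inner_products_le (x := u j) (s := Finset.univ)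
    refine le_trans (le_of_eq ?_) (this.trans (hu j))
    refine Finset.sum_congr rfl fun i _ => ?_
    rw [real_inner_comm, Real.norm_eq_abs, sq_abs]
  have : Nonempty (Fin d) := ⟨⟨0, hW⟩⟩
  obtain ⟨i, -, hi⟩ := Finset.exists_le_of_sum_le Finset.univ_nonempty hsum
  refine ⟨e i, (e i).2, he.1 i, ?_⟩
  have hd : (0 : ℝ) < d := by exact_mod_cast hW
  rw [le_div_iff₀ hd] at hi
  linarith

lemma cosh_le_one_add_sq {s : ℝ} (hs : s ^ 2 ≤ 2) : Real.cosh s ≤ 1 + s ^ 2 := by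
  refine (Real.cosh_le_exp_half_sq s).trans ?_
  have h := Real.abs_exp_sub_one_sub_id_le (x := s ^ 2 / 2)
    (by rw [abs_of_nonneg (by positivity)]; linarith)
  have h2 := (abs_le.1 h).2
  nlinarith [sq_nonneg s]

lemma exists_small_step {ι κ : Type*} [Fintype ι] [Fintype κ] (x y : ι → ℝ) (F : Finset ι)
    (l u : ι → ℝ) (hF : ∀ i ∈ F, l i < x i ∧ x i < u i) (p q : κ → ℝ) (J : Finset κ) (Q : ℝ)
    (hJ : ∀ j ∈ J, |p j| < Q) (c : ℝ) :
    ∃ δ : ℝ, 0 < δ ∧ (∀ i ∈ F, ∀ s : ℝ, |s| ≤ δ → l i ≤ x i + s * y i ∧ x i + s * y i ≤ u i) ∧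
      (∀ j ∈ J, ∀ s : ℝ, |s| ≤ δ → |p j + s * q j| ≤ Q) ∧ ∀ j, (c * (δ * q j)) ^ 2 ≤ 2 := by
  have h1 : ∀ᶠ s in nhds (0 : ℝ), ∀ i ∈ F, l i ≤ x i + s * y i ∧ x i + s * y i ≤ u i := by
    rw [Filter.eventually_all_finset]
    intro i hi
    have hc : Filter.Tendsto (fun s : ℝ => x i + s * y i) (nhds 0) (nhds (x i)) := by
      have : Continuous (fun s : ℝ => x i + s * y i) := by fun_prop
      simpa using this.tendsto 0
    filter_upwards [hc.eventually (lt_mem_nhds (hF i hi).1),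
      hc.eventually (gt_mem_nhds (hF i hi).2)] with s a b using ⟨a.le, b.le⟩
  have h2 : ∀ᶠ s in nhds (0 : ℝ), ∀ j ∈ J, |p j + s * q j| ≤ Q := by
    rw [Filter.eventually_all_finset]
    intro j hj
    have hc : Filter.Tendsto (fun s : ℝ => |p j + s * q j|) (nhds 0) (nhds |p j|) := by
      have : Continuous (fun s : ℝ => |p j + s * q j|) := by fun_prop
      simpa using this.tendsto 0
    filter_upwards [hc.eventually (gt_mem_nhds (hJ j hj))] with s a using a.le
  have h3 : ∀ᶠ s in nhds (0 : ℝ), ∀ j, (c * (s * q j)) ^ 2 ≤ 2 := by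
    rw [Filter.eventually_all]
    intro j
    have hc : Filter.Tendsto (fun s : ℝ => (c * (s * q j)) ^ 2) (nhds 0) (nhds 0) := by
      have : Continuous (fun s : ℝ => (c * (s * q j)) ^ 2) := by fun_prop
      simpa using this.tendsto 0
    filter_upwards [hc.eventually (gt_mem_nhds (show (0 : ℝ) < 2 by norm_num))] with s a using a.le
  obtain ⟨ε, hε, h⟩ := Metric.eventually_nhds_iff.1 (h1.and (h2.and h3))
  have key : ∀ s : ℝ, |s| ≤ ε / 2 → _ := fun s hs =>
    h (y := s) (by rw [Real.dist_eq, sub_zero]; linarith)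
  refine ⟨ε / 2, by linarith, fun i hi s hs => (key s hs).1 i hi,
    fun j hj s hs => (key s hs).2.1 j hj, fun j => (key (ε / 2) ?_).2.2 j⟩
  rw [abs_of_pos (by linarith)]

lemma exists_orthogonal_direction {ι κ : Type*} [Fintype ι] [Fintype κ]
    (v : κ → ι → ℝ) (hv : ∀ j i, |v j i| ≤ 1) (b : ι → ℝ) (F : Finset ι) (J : Finset κ)
    (hF : 4 ≤ F.card) (hJ : 4 * J.card ≤ F.card) (w : κ → ℝ) (hw : ∀ j, 0 ≤ w j) :
    ∃ y : ι → ℝ, (∀ i ∉ F, y i = 0) ∧ ∑ i, y i = 0 ∧ ∑ i, b i * y i = 0 ∧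
      (∀ j ∈ J, ∑ i, y i * v j i = 0) ∧ ∑ i, y i ^ 2 = 1 ∧
      ∑ j, w j * (∑ i, y i * v j i) ^ 2 ≤ 4 * ∑ j, w j := by
  classical
  let E := EuclideanSpace ℝ ι
  let S : Finset E := (Finset.univ \ F).image (fun i => EuclideanSpace.single i (1 : ℝ)) ∪
    ({WithLp.toLp 2 (fun _ => (1 : ℝ)), WithLp.toLp 2 b} ∪ J.image (fun j => WithLp.toLp 2 (v j)))
  have hS : S.card ≤ (Fintype.card ι - F.card) + (2 + J.card) := by
    refine (Finset.card_union_le _ _).trans (Nat.add_le_add ?_ ?_)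
    · refine Finset.card_image_le.trans ?_
      rw [Finset.card_sdiff_of_subset (Finset.subset_univ _), Finset.card_univ]
    · exact (Finset.card_union_le _ _).trans
        (Nat.add_le_add Finset.card_le_two Finset.card_image_le)
  let W : Submodule ℝ E := (Submodule.span ℝ (S : Set E))ᗮ
  have hdim : F.card ≤ 4 * Module.finrank ℝ W := by
    have h1 := Submodule.finrank_add_finrank_orthogonal (Submodule.span ℝ (S : Set E))
    have h2 := finrank_span_finset_le_card (R := ℝ) S
    have h3 : Module.finrank ℝ E = Fintype.card ι := finrank_euclideanSpace
    have h4 : F.card ≤ Fintype.card ι := Finset.card_le_univ F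
    have h5 : Set.finrank ℝ (S : Set E) = Module.finrank ℝ (Submodule.span ℝ (S : Set E)) := rfl
    change _ ≤ 4 * Module.finrank ℝ (Submodule.span ℝ (S : Set E))ᗮ
    omega
  obtain ⟨y, hyW, hy1, hy⟩ := exists_unit_weighted_sq_le W w hw
    (fun j => WithLp.toLp 2 (fun i => if i ∈ F then v j i else 0)) F.card (by
      intro j
      rw [EuclideanSpace.norm_sq_eq]
      have h1 : ∀ i, ‖(if i ∈ F then v j i else 0 : ℝ)‖ ^ 2 ≤ if i ∈ F then 1 else 0 := by
        intro i
        split_ifs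
        · rw [Real.norm_eq_abs, sq_abs, sq_le_one_iff_abs_le_one]; exact hv j i
        · simp
      refine (Finset.sum_le_sum fun i _ => h1 i).trans ?_
      simp) (by omega)
  have hmem : ∀ z ∈ S, inner ℝ z y = 0 := fun z hz =>
    (Submodule.mem_orthogonal _ _).1 hyW z (Submodule.subset_span hz)
  have hin : ∀ g : ι → ℝ, inner ℝ (WithLp.toLp 2 g : E) y = ∑ i, y i * g i := by
    intro g
    simp [PiLp.inner_apply]
  have hy0 : ∀ i ∉ F, y i = 0 := by
    intro i hi
    have := hmem (EuclideanSpace.single i (1 : ℝ)) (Finset.mem_union_left _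
      (Finset.mem_image_of_mem _ (by simpa using hi)))
    have h2 := (EuclideanSpace.inner_single_left (𝕜 := ℝ) i (1 : ℝ) y).symm.trans this
    simpa using h2
  refine ⟨fun i => y i, hy0, ?_, ?_, ?_, ?_, ?_⟩
  · have := hmem (WithLp.toLp 2 (fun _ => (1 : ℝ))) (by simp [S])
    rw [hin] at this
    simpa using this
  · have := hmem (WithLp.toLp 2 b) (by simp [S])
    rw [hin] at this
    simpa [mul_comm] using this
  · intro j hj
    have := hmem (WithLp.toLp 2 (v j)) (Finset.mem_union_right _ (Finset.mem_union_right _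
      (Finset.mem_image_of_mem _ hj)))
    rwa [hin] at this
  · have := EuclideanSpace.norm_sq_eq y
    rw [hy1] at this
    simpa using this.symm
  · have h1 : ∀ j, inner ℝ (WithLp.toLp 2 (fun i => if i ∈ F then v j i else 0) : E) y
        = ∑ i, y i * v j i := by
      intro j
      rw [hin]
      refine Finset.sum_congr rfl fun i _ => ?_
      split_ifs with h
      · rfl
      · rw [hy0 i h]; ring
    simp only [h1] at hy
    have h2 : (0 : ℝ) ≤ ∑ j, w j := Finset.sum_nonneg fun j _ => hw j
    have h3 : (F.card : ℝ) ≤ 4 * (Module.finrank ℝ W : ℝ) := by exact_mod_cast hdim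
    have h4 : (0 : ℝ) < F.card := by exact_mod_cast (by omega : 0 < F.card)
    have h5 : (Module.finrank ℝ W : ℝ) * ∑ j, w j * (∑ i, y i * v j i) ^ 2
        ≤ (Module.finrank ℝ W : ℝ) * (4 * ∑ j, w j) := by nlinarith
    exact le_of_mul_le_mul_left h5 (by linarith)

/-- Sparsification: a nonnegative vector of sum at most `A` can be replaced by one with at most
`2 μ` nonzero entries, so that `M` given functionals with coefficients in `[-1, 1]` change by at
most `A T / √μ`, where `cosh T` is of order `M / μ`. -/
theorem exists_sparse_nonneg {ι κ : Type*} [Fintype ι] [Fintype κ]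
    (v : κ → ι → ℝ) (hv : ∀ j i, |v j i| ≤ 1) (a : ι → ℝ) (ha : ∀ i, 0 ≤ a i) {A : ℝ}
    (hA : 0 < A) (haA : ∑ i, a i ≤ A) {μ : ℝ} (hμ : 4 ≤ μ) {T : ℝ} (hT : 0 ≤ T)
    (hMT : 4 * Real.exp 4 * Fintype.card κ ≤ μ * Real.cosh T) :
    ∃ b : ι → ℝ, ((Finset.univ.filter fun i => b i ≠ 0).card : ℝ) ≤ 2 * μ ∧
      ∀ j, |∑ i, (b i - a i) * v j i| ≤ A / √μ * T := by
  classical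
  have hμ0 : 0 < μ := by linarith
  have hsμ : 0 < √μ := Real.sqrt_pos.2 hμ0
  set B := A / μ with hB
  have hB0 : 0 < B := by positivity
  set lam := √μ / A with hlam
  have hlam0 : 0 < lam := by positivity
  set Q := A / √μ * T with hQ
  have hlamQ : lam * Q = T := by rw [hlam, hQ]; field_simp
  have hlamB : lam ^ 2 * (B * A) = 1 := by
    rw [hlam, hB, div_pow, Real.sq_sqrt hμ0.le]; field_simp
  let l : ι → ℝ := fun i => if a i < B then 0 else a i
  let u : ι → ℝ := fun i => if a i < B then B else a i
  let P : κ → (ι → ℝ) → ℝ := fun j b => ∑ i, (b i - a i) * v j i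
  let Φ : (ι → ℝ) → ℝ := fun b => ∑ j, Real.cosh (lam * P j b)
  let M : ℝ := Fintype.card κ
  let K : Set (ι → ℝ) := {b | b ∈ Set.Icc l u ∧ ∑ i, b i = ∑ i, a i ∧ (∀ j, |P j b| ≤ Q) ∧
    Φ b ≤ M * Real.exp (4 * lam ^ 2 * (∑ i, b i ^ 2 - ∑ i, a i ^ 2))}
  have hPc : ∀ j, Continuous (P j) := fun j => by fun_prop
  have hΦc : Continuous Φ :=
    continuous_finsetSum _ fun j _ => Real.continuous_cosh.comp (continuous_const.mul (hPc j))
  have hK : IsCompact K := by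
    refine isCompact_Icc.of_isClosed_subset (s := Set.Icc l u) ?_ fun b hb => hb.1
    refine isClosed_Icc.and (IsClosed.and ?_ (IsClosed.and ?_ ?_))
    · exact isClosed_eq (by fun_prop) continuous_const
    · simp only [Set.ofPred_forall]
      exact isClosed_iInter fun j => isClosed_le (hPc j).abs continuous_const
    · exact isClosed_le hΦc (by fun_prop)
  have haK : a ∈ K := by
    refine ⟨⟨fun i => ?_, fun i => ?_⟩, rfl, fun j => ?_, ?_⟩
    · simp only [l]; split_ifs; exacts [ha i, le_rfl]
    · simp only [u]; split_ifs with h; exacts [h.le, le_rfl]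
    · simp only [P, sub_self, zero_mul, Finset.sum_const_zero, abs_zero]; positivity
    · simp [Φ, P, M]
  obtain ⟨b, hbK, hmax⟩ := hK.exists_isMaxOn ⟨a, haK⟩
    (f := fun b : ι → ℝ => ∑ i, b i ^ 2) (by fun_prop)
  obtain ⟨hbI, hbs, hbQ, hbΦ⟩ := hbK
  have hl0 : ∀ i, 0 ≤ l i := fun i => by simp only [l]; split_ifs; exacts [le_rfl, ha i]
  have hb0 : ∀ i, 0 ≤ b i := fun i => (hl0 i).trans (hbI.1 i)
  have hbA : ∑ i, b i ≤ A := hbs.trans_le haA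
  let F : Finset ι := Finset.univ.filter fun i => l i < b i ∧ b i < u i
  suffices hFμ : (F.card : ℝ) ≤ μ by
    refine ⟨b, ?_, hbQ⟩
    let G : Finset ι := Finset.univ.filter fun i => B ≤ b i
    have hG : (G.card : ℝ) ≤ μ := by
      have h1 : (G.card : ℝ) * B ≤ A := by
        calc (G.card : ℝ) * B = ∑ i ∈ G, B := by rw [Finset.sum_const, nsmul_eq_mul]
          _ ≤ ∑ i ∈ G, b i := Finset.sum_le_sum fun i hi => (Finset.mem_filter.1 hi).2
          _ ≤ ∑ i, b i := Finset.sum_le_sum_of_subset_of_nonneg (Finset.subset_univ _)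
              fun i _ _ => hb0 i
          _ ≤ A := hbA
      rw [hB, mul_div_assoc', div_le_iff₀ hμ0] at h1
      nlinarith
    have hsub : (Finset.univ.filter fun i => b i ≠ 0) ⊆ F ∪ G := by
      intro i hi
      have hne := (Finset.mem_filter.1 hi).2
      have h1 := hbI.1 i
      have h2 := hbI.2 i
      simp only [Finset.mem_union, F, G, Finset.mem_filter, Finset.mem_univ, true_and]
      simp only [l, u] at h1 h2 ⊢
      split_ifs at h1 h2 ⊢ with h
      · by_cases h3 : b i < B
        · exact Or.inl ⟨lt_of_le_of_ne h1 (Ne.symm hne), h3⟩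
        · exact Or.inr (not_lt.1 h3)
      · exact Or.inr ((not_lt.1 h).trans h1)
    have h1 : ((Finset.univ.filter fun i => b i ≠ 0).card : ℝ) ≤ F.card + G.card := by
      exact_mod_cast (Finset.card_le_card hsub).trans (Finset.card_union_le _ _)
    linarith
  by_contra! hFμ
  let J : Finset κ := Finset.univ.filter fun j => ¬ |P j b| < Q
  have hcosh : 0 < Real.cosh T := Real.cosh_pos T
  have hΦM : Φ b ≤ M * Real.exp 4 := by
    refine hbΦ.trans (mul_le_mul_of_nonneg_left (Real.exp_le_exp.2 ?_) (Nat.cast_nonneg _))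
    have h1 : ∑ i, b i ^ 2 - ∑ i, a i ^ 2 ≤ B * A := by
      rw [← Finset.sum_sub_distrib]
      refine (Finset.sum_le_sum fun i _ => (?_ : _ ≤ B * b i)).trans ?_
      · have h1 := hbI.1 i
        have h2 := hbI.2 i
        simp only [l, u] at h1 h2
        have := ha i
        split_ifs at h1 h2 with h
        · nlinarith
        · have : b i = a i := le_antisymm h2 h1
          rw [this]; nlinarith
      · rw [← Finset.mul_sum]; exact mul_le_mul_of_nonneg_left hbA hB0.le
    nlinarith [sq_nonneg lam]
  have hJ : 4 * (J.card : ℝ) ≤ μ := by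
    have h1 : (J.card : ℝ) * Real.cosh T ≤ Φ b := by
      calc (J.card : ℝ) * Real.cosh T = ∑ j ∈ J, Real.cosh T := by
            rw [Finset.sum_const, nsmul_eq_mul]
        _ ≤ ∑ j ∈ J, Real.cosh (lam * P j b) := Finset.sum_le_sum fun j hj => by
            rw [Real.cosh_le_cosh, abs_of_nonneg hT, abs_mul, abs_of_pos hlam0, ← hlamQ]
            exact mul_le_mul_of_nonneg_left (not_lt.1 (Finset.mem_filter.1 hj).2) hlam0.le
        _ ≤ Φ b := Finset.sum_le_sum_of_subset_of_nonneg (Finset.subset_univ _)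
            fun j _ _ => (Real.cosh_pos _).le
    have h2 : 4 * (J.card : ℝ) * Real.cosh T ≤ μ * Real.cosh T := by
      calc _ ≤ 4 * (M * Real.exp 4) := by linarith
        _ ≤ _ := by simp only [M]; linarith
    exact le_of_mul_le_mul_right h2 hcosh
  obtain ⟨y, hyF, hy1, hyb, hyJ, hyn, hyq⟩ := exists_orthogonal_direction v hv b F J
    (by exact_mod_cast hμ.trans hFμ.le) (by exact_mod_cast hJ.trans hFμ.le)
    (fun j => Real.cosh (lam * P j b)) fun j => (Real.cosh_pos _).le
  set q : κ → ℝ := fun j => ∑ i, y i * v j i with hq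
  obtain ⟨δ, hδ, hδF, hδJ, hδq⟩ := exists_small_step b y F l u
    (fun i hi => (Finset.mem_filter.1 hi).2) (fun j => P j b) q Jᶜ Q
    (fun j hj => by simpa [J] using hj) lam
  have hPs : ∀ j (s : ℝ), P j (fun i => b i + s * y i) = P j b + s * q j := by
    intro j s
    simp only [P, hq, Finset.mul_sum, ← Finset.sum_add_distrib]
    exact Finset.sum_congr rfl fun i _ => by ring
  have hsq : ∀ s : ℝ, ∑ i, (b i + s * y i) ^ 2 = ∑ i, b i ^ 2 + s ^ 2 := by
    intro s
    have : ∀ i, (b i + s * y i) ^ 2 = b i ^ 2 + 2 * s * (b i * y i) + s ^ 2 * y i ^ 2 :=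
      fun i => by ring
    simp only [this, Finset.sum_add_distrib, ← Finset.mul_sum, hyb, hyn]
    ring
  have hpot : ∃ s : ℝ, |s| = δ ∧
      Φ (fun i => b i + s * y i) ≤ Φ b * Real.exp (4 * lam ^ 2 * δ ^ 2) := by
    have hadd : Φ (fun i => b i + δ * y i) + Φ (fun i => b i + (-δ) * y i) ≤
        2 * (Φ b * Real.exp (4 * lam ^ 2 * δ ^ 2)) := by
      have hterm : ∀ j, Real.cosh (lam * P j (fun i => b i + δ * y i)) +
          Real.cosh (lam * P j (fun i => b i + (-δ) * y i)) ≤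
          2 * Real.cosh (lam * P j b) + 2 * (lam * δ) ^ 2 * (Real.cosh (lam * P j b) * q j ^ 2) := by
        intro j
        rw [hPs, hPs]
        have e1 : lam * (P j b + δ * q j) = lam * P j b + lam * (δ * q j) := by ring
        have e2 : lam * (P j b + -δ * q j) = lam * P j b - lam * (δ * q j) := by ring
        rw [e1, e2, Real.cosh_add, Real.cosh_sub]
        have := mul_le_mul_of_nonneg_left (cosh_le_one_add_sq (hδq j))
          (Real.cosh_pos (lam * P j b)).le
        nlinarith
      have hsum : Φ (fun i => b i + δ * y i) + Φ (fun i => b i + (-δ) * y i) ≤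
          2 * Φ b + 2 * (lam * δ) ^ 2 * ∑ j, Real.cosh (lam * P j b) * q j ^ 2 := by
        simp only [Φ, Finset.mul_sum, ← Finset.sum_add_distrib]
        exact Finset.sum_le_sum fun j _ => by
          have := hterm j
          linarith
      have h0 : 0 ≤ Φ b := Finset.sum_nonneg fun j _ => (Real.cosh_pos _).le
      have h1 := Real.add_one_le_exp (4 * lam ^ 2 * δ ^ 2)
      have h2 : 2 * (lam * δ) ^ 2 * ∑ j, Real.cosh (lam * P j b) * q j ^ 2 ≤
          2 * (lam * δ) ^ 2 * (4 * Φ b) := mul_le_mul_of_nonneg_left hyq (by positivity)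
      nlinarith [mul_le_mul_of_nonneg_left h1 h0]
    by_cases h : Φ (fun i => b i + δ * y i) ≤ Φ b * Real.exp (4 * lam ^ 2 * δ ^ 2)
    · exact ⟨δ, abs_of_pos hδ, h⟩
    · exact ⟨-δ, by rw [abs_neg, abs_of_pos hδ], by linarith⟩
  obtain ⟨s, hs, hΦs⟩ := hpot
  have hs2 : s ^ 2 = δ ^ 2 := by rw [← sq_abs, hs]
  have hmem : (fun i => b i + s * y i) ∈ K := by
    refine ⟨⟨fun i => ?_, fun i => ?_⟩, ?_, fun j => ?_, ?_⟩
    · by_cases hi : i ∈ F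
      · exact (hδF i hi s hs.le).1
      · simpa [hyF i hi] using hbI.1 i
    · by_cases hi : i ∈ F
      · exact (hδF i hi s hs.le).2
      · simpa [hyF i hi] using hbI.2 i
    · rw [Finset.sum_add_distrib, ← Finset.mul_sum, hy1, mul_zero, add_zero, hbs]
    · rw [hPs]
      by_cases hj : j ∈ J
      · have : q j = 0 := hyJ j hj
        rw [this, mul_zero, add_zero]; exact hbQ j
      · exact hδJ j (Finset.mem_compl.2 hj) s hs.le
    · rw [hsq, hs2]
      refine hΦs.trans ((mul_le_mul_of_nonneg_right hbΦ (Real.exp_pos _).le).trans_eq ?_)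
      rw [mul_assoc, ← Real.exp_add]
      congr 2
      ring
  have := hmax hmem
  simp only [Set.mem_ofPred_eq, hsq, hs2] at this
  nlinarith [pow_pos hδ 2]

end Sparse

section Basics

lemma fourier_apply_add (n : ℤ) (x y : Torus) :
    fourier n (x + y) = fourier n x * fourier n y := by
  simp only [fourier_apply, zsmul_add, AddCircle.toCircle_add, Circle.coe_mul]

lemma norm_fourier_apply (n : ℤ) (x : Torus) : ‖fourier n x‖ = 1 := by
  simp only [fourier_apply, Circle.norm_coe]

lemma fourier_coe_eq (n : ℤ) (h : ℝ) :
    fourier n (h : Torus) = Complex.exp (((n * h : ℝ) : ℂ) * Complex.I) := by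
  rw [fourier_coe_apply]
  congr 1
  have : (Real.pi : ℂ) ≠ 0 := by exact_mod_cast Real.pi_ne_zero
  push_cast
  field_simp

lemma fourier_apply_neg (n : ℤ) (x : Torus) : fourier n (-x) = fourier (-n) x := by
  simp only [fourier_apply, smul_neg, neg_smul]

lemma fourier_zero_apply (x : Torus) : fourier 0 x = 1 := fourier_zero

lemma integral_fourier (n : ℤ) :
    ∫ x : Torus, fourier n x ∂AddCircle.haarAddCircle = if n = 0 then 1 else 0 := by
  have h := fourierCoeff_fourier (T := 2 * Real.pi) n
  have h0 := congrFun h 0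
  simp only [fourierCoeff, neg_zero, fourier_zero_apply, one_smul] at h0
  rw [h0, Pi.single_apply]
  simp [eq_comm]

lemma continuous_trigPoly (Θ : Finset ℤ) (c : ℤ → ℂ) : Continuous (trigPoly Θ c) := by
  unfold trigPoly; fun_prop

/-- The equidistant nodes `2 π l / L`. -/
def gridPoint (L l : ℕ) : Torus := ((2 * Real.pi * l / L : ℝ) : Torus)

lemma sum_fourier_gridPoint {L : ℕ} (hL : 0 < L) (n : ℤ) (hn : |n| < L) :
    ∑ l ∈ Finset.range L, fourier n (gridPoint L l) = if n = 0 then (L : ℂ) else 0 := by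
  split_ifs with h0
  · simp only [h0, fourier_zero_apply]; simp
  have hLC : (L : ℂ) ≠ 0 := by exact_mod_cast hL.ne'
  set ζ : ℂ := Complex.exp (2 * Real.pi * Complex.I * (n / L : ℂ)) with hζ
  have h1 : ∀ l : ℕ, fourier n (gridPoint L l) = ζ ^ l := by
    intro l
    rw [gridPoint, fourier_coe_eq, hζ, ← Complex.exp_nat_mul]
    congr 1
    push_cast
    field_simp
  have h2 : ζ ^ L = 1 := by
    rw [hζ, ← Complex.exp_nat_mul, Complex.exp_eq_one_iff]
    exact ⟨n, by field_simp⟩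
  have h3 : ζ ≠ 1 := by
    rw [hζ, Ne, Complex.exp_eq_one_iff]
    rintro ⟨q, hq⟩
    have hpi : (2 * Real.pi * Complex.I : ℂ) ≠ 0 := Complex.two_pi_I_ne_zero
    have h4 : (n : ℂ) / L = q := by
      have : (2 * Real.pi * Complex.I : ℂ) * (n / L) = (2 * Real.pi * Complex.I) * q := by
        rw [hq]; ring
      exact mul_left_cancel₀ hpi this
    rw [div_eq_iff hLC] at h4
    have h5 : n = q * L := by exact_mod_cast h4
    have h6 : n = 0 := Int.eq_zero_of_abs_lt_dvd (Dvd.intro_left q h5.symm) hn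
    exact h0 h6
  simp_rw [h1]
  have := mul_geom_sum ζ L
  rw [h2, sub_self] at this
  exact (mul_eq_zero.1 this).resolve_left (sub_ne_zero.2 h3)

/-- `N` times the Fejér kernel of order `N`. -/
def fejerSum (N : ℕ) (x : Torus) : ℂ := ∑ j ∈ Finset.range N, dirichletKernel j x

lemma fejerSum_eq_normSq (N : ℕ) (x : Torus) :
    fejerSum N x = ((Complex.normSq (∑ a ∈ Finset.range N, fourier (a : ℤ) x) : ℝ) : ℂ) := by
  have hdir : ∀ N : ℕ, dirichletKernel N x = 1 + ∑ a ∈ Finset.range N, fourier (a - N : ℤ) x +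
      ∑ a ∈ Finset.range N, fourier (N - a : ℤ) x := by
    intro N
    induction N with
    | zero => simp [dirichletKernel]
    | succ N ih =>
      have h1 : dirichletKernel (N + 1) x = dirichletKernel N x + fourier (-(N + 1 : ℤ)) x
          + fourier (N + 1 : ℤ) x := by
        unfold dirichletKernel
        have : Finset.Icc (-((N + 1 : ℕ) : ℤ)) ((N + 1 : ℕ) : ℤ) =
            insert (-(N + 1 : ℤ)) (insert (N + 1 : ℤ) (Finset.Icc (-(N : ℤ)) N)) := by
          ext z; simp only [Finset.mem_Icc, Finset.mem_insert]; push_cast; omega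
        rw [this, Finset.sum_insert, Finset.sum_insert]
        · ring
        · simp
        · simp; omega
      rw [h1, ih, Finset.sum_range_succ', Finset.sum_range_succ']
      push_cast
      simp only [add_sub_add_right_eq_sub, zero_sub, sub_zero]
      ring
  induction N with
  | zero => simp [fejerSum]
  | succ N ih =>
    rw [fejerSum, Finset.sum_range_succ, ← fejerSum, ih, hdir, Finset.sum_range_succ,
      ← Complex.mul_conj, ← Complex.mul_conj, map_add, map_sum]
    have hc : ∀ n : ℤ, (starRingEnd ℂ) (fourier n x) = fourier (-n) x := fun n => fourier_neg.symm
    simp only [hc]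
    have h1 : ∑ a ∈ Finset.range N, fourier (a - N : ℤ) x =
        (∑ a ∈ Finset.range N, fourier (a : ℤ) x) * fourier (-N : ℤ) x := by
      rw [Finset.sum_mul]
      exact Finset.sum_congr rfl fun a _ => by rw [sub_eq_add_neg, fourier_add]
    have h2 : ∑ a ∈ Finset.range N, fourier (N - a : ℤ) x =
        (∑ a ∈ Finset.range N, fourier (-(a : ℤ)) x) * fourier (N : ℤ) x := by
      rw [Finset.sum_mul]
      exact Finset.sum_congr rfl fun a _ => by rw [sub_eq_neg_add, fourier_add]
    have h3 : fourier (N : ℤ) x * fourier (-(N : ℤ)) x = 1 := by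
      rw [← fourier_add, add_neg_cancel, fourier_zero_apply]
    rw [h1, h2]
    linear_combination -h3

lemma fejerSum_eq_norm (N : ℕ) (x : Torus) : fejerSum N x = ((‖fejerSum N x‖ : ℝ) : ℂ) := by
  rw [fejerSum_eq_normSq, Complex.norm_real, Real.norm_of_nonneg (Complex.normSq_nonneg _)]

lemma card_filter_natAbs_le (N : ℕ) (k : ℤ) :
    ((Finset.range N).filter fun j : ℕ => k.natAbs ≤ j).card = N - k.natAbs := by
  have : ((Finset.range N).filter fun j : ℕ => k.natAbs ≤ j) = Finset.Ico k.natAbs N := by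
    ext j; simp [and_comm]
  rw [this, Nat.card_Ico]

lemma sum_fejerSum_gridPoint {L : ℕ} (hL : 0 < L) (N : ℕ) (k : ℤ) (hk : k.natAbs + N ≤ L) :
    ∑ l ∈ Finset.range L, fejerSum N (gridPoint L l) * fourier k (gridPoint L l) =
      L * ((N - k.natAbs : ℕ) : ℂ) := by
  have h1 : ∀ j ∈ Finset.range N, ∑ l ∈ Finset.range L,
      dirichletKernel j (gridPoint L l) * fourier k (gridPoint L l) =
      if k.natAbs ≤ j then (L : ℂ) else 0 := by
    intro j hj
    have hj := Finset.mem_range.1 hj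
    simp only [dirichletKernel, Finset.sum_mul, ← fourier_add]
    rw [Finset.sum_comm]
    have : ∀ m ∈ Finset.Icc (-(j : ℤ)) j, ∑ l ∈ Finset.range L, fourier (m + k) (gridPoint L l) =
        if m = -k then (L : ℂ) else 0 := by
      intro m hm
      have hm := Finset.mem_Icc.1 hm
      rw [sum_fourier_gridPoint hL _ (abs_lt.2 ⟨by omega, by omega⟩)]
      congr 1
      rw [eq_neg_iff_add_eq_zero]
    rw [Finset.sum_congr rfl this, Finset.sum_ite_eq']
    congr 1
    simp only [Finset.mem_Icc, eq_iff_iff]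
    omega
  simp only [fejerSum, Finset.sum_mul]
  rw [Finset.sum_comm, Finset.sum_congr rfl h1, ← Finset.sum_filter, Finset.sum_const,
    card_filter_natAbs_le, nsmul_eq_mul, mul_comm]

/-- Differentiation of trigonometric polynomials of degree at most `N` is a combination of
translations with coefficients of total mass at most `2 N`. -/
lemma exists_bernstein_translates {N : ℕ} (hN : 0 < N) :
    ∃ K : ℕ → ℂ, ∑ l ∈ Finset.range (3 * N), ‖K l‖ ≤ 2 * N ∧
      ∀ n : ℤ, n.natAbs ≤ N → Complex.I * n =
        ∑ l ∈ Finset.range (3 * N), K l * fourier n (-gridPoint (3 * N) l) := by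
  have hL : 0 < 3 * N := by omega
  have hLC : ((3 * N : ℕ) : ℂ) ≠ 0 := by exact_mod_cast hL.ne'
  refine ⟨fun l => Complex.I * ((3 * N : ℕ) : ℂ)⁻¹ * fejerSum N (gridPoint (3 * N) l) *
    (fourier (N : ℤ) (gridPoint (3 * N) l) - fourier (-N : ℤ) (gridPoint (3 * N) l)), ?_, ?_⟩
  · have h0 := sum_fejerSum_gridPoint hL N 0 (by simp; omega)
    simp only [fourier_zero_apply, mul_one, Int.natAbs_zero, tsub_zero] at h0
    have h1 : ∑ l ∈ Finset.range (3 * N), ‖fejerSum N (gridPoint (3 * N) l)‖ =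
        ((3 * N : ℕ) : ℝ) * N := by
      have : ((∑ l ∈ Finset.range (3 * N), ‖fejerSum N (gridPoint (3 * N) l)‖ : ℝ) : ℂ) =
          ((3 * N : ℕ) : ℂ) * N := by
        rw [← h0, Complex.ofReal_sum]
        exact Finset.sum_congr rfl fun l _ => (fejerSum_eq_norm _ _).symm
      exact_mod_cast this
    calc _ ≤ ∑ l ∈ Finset.range (3 * N),
          2 * ((3 * N : ℕ) : ℝ)⁻¹ * ‖fejerSum N (gridPoint (3 * N) l)‖ := by
          refine Finset.sum_le_sum fun l _ => ?_
          rw [norm_mul, norm_mul, norm_mul, Complex.norm_I, one_mul, norm_inv, Complex.norm_natCast]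
          have : ‖fourier (N : ℤ) (gridPoint (3 * N) l) - fourier (-N : ℤ) (gridPoint (3 * N) l)‖
              ≤ 2 := (norm_sub_le _ _).trans (by simp only [norm_fourier_apply]; norm_num)
          nlinarith [show 0 ≤ ((3 * N : ℕ) : ℝ)⁻¹ * ‖fejerSum N (gridPoint (3 * N) l)‖ by positivity]
      _ = 2 * N := by
          rw [← Finset.mul_sum, h1]
          have : ((3 * N : ℕ) : ℝ) ≠ 0 := by exact_mod_cast hL.ne'
          field_simp
  · intro n hn
    have h1 := sum_fejerSum_gridPoint hL N (N - n) (by omega)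
    have h2 := sum_fejerSum_gridPoint hL N (-N - n) (by omega)
    have h3 : ∀ l, Complex.I * ((3 * N : ℕ) : ℂ)⁻¹ * fejerSum N (gridPoint (3 * N) l) *
        (fourier (N : ℤ) (gridPoint (3 * N) l) - fourier (-N : ℤ) (gridPoint (3 * N) l)) *
        fourier n (-gridPoint (3 * N) l) =
        Complex.I * ((3 * N : ℕ) : ℂ)⁻¹ *
          (fejerSum N (gridPoint (3 * N) l) * fourier (N - n : ℤ) (gridPoint (3 * N) l) -
           fejerSum N (gridPoint (3 * N) l) * fourier (-N - n : ℤ) (gridPoint (3 * N) l)) := by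
      intro l
      rw [fourier_apply_neg, sub_eq_add_neg (N : ℤ) n, sub_eq_add_neg (-N : ℤ) n, fourier_add,
        fourier_add]
      ring
    simp only [h3]
    rw [← Finset.mul_sum, Finset.sum_sub_distrib, h1, h2]
    have h4 : (((N - (N - n : ℤ).natAbs : ℕ) : ℂ) - ((N - (-N - n : ℤ).natAbs : ℕ) : ℂ)) = n := by
      have : (((N - (N - n : ℤ).natAbs : ℕ) : ℤ) - ((N - (-N - n : ℤ).natAbs : ℕ) : ℤ)) = n := by
        omega
      exact_mod_cast this
    rw [← mul_sub, h4]
    field_simp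

lemma torusNorm_comp_add (p : ℝ≥0∞) {f : Torus → ℂ}
    (hf : AEStronglyMeasurable f AddCircle.haarAddCircle) (y : Torus) :
    torusNorm p (fun x => f (x + y)) = torusNorm p f :=
  eLpNorm_comp_measurePreserving hf (measurePreserving_add_right AddCircle.haarAddCircle y)

lemma torusNorm_le_of_bound (p : ℝ≥0∞) {f : Torus → ℂ} {C : ℝ} (hC : ∀ x, ‖f x‖ ≤ C) :
    torusNorm p f ≤ ENNReal.ofReal C := by
  refine (eLpNorm_le_of_ae_bound (p := p) (Filter.Eventually.of_forall hC)).trans ?_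
  simp

lemma norm_le_of_torusNorm_top {f : Torus → ℂ} (hf : Continuous f) {C : ℝ} (hC : 0 ≤ C)
    (h : torusNorm ∞ f ≤ ENNReal.ofReal C) (x : Torus) : ‖f x‖ ≤ C := by
  have h1 : ∀ᵐ x ∂AddCircle.haarAddCircle, ‖f x‖ ≤ C := by
    have := enorm_ae_le_eLpNormEssSup f (AddCircle.haarAddCircle (T := 2 * Real.pi))
    filter_upwards [this] with x hx
    rw [torusNorm, eLpNorm_exponent_top] at h
    have h2 := hx.trans h
    rw [← ofReal_norm] at h2
    exact (ENNReal.ofReal_le_ofReal_iff hC).1 h2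
  have h2 : Dense {x | ‖f x‖ ≤ C} := Measure.dense_of_ae h1
  have h3 : IsClosed {x | ‖f x‖ ≤ C} := isClosed_le hf.norm continuous_const
  have : x ∈ closure {x | ‖f x‖ ≤ C} := h2 x
  rwa [h3.closure_eq] at this

lemma torusNorm_deriv_le {p : ℝ≥0∞} (hp : 1 ≤ p) {N : ℕ} (hN : 0 < N) (Θ : Finset ℤ)
    (hΘ : ∀ n ∈ Θ, n.natAbs ≤ N) (c : ℤ → ℂ) :
    torusNorm p (trigPoly Θ fun n => Complex.I * n * c n) ≤
      ENNReal.ofReal (2 * N) * torusNorm p (trigPoly Θ c) := by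
  obtain ⟨K, hK, hKn⟩ := exists_bernstein_translates hN
  have h1 : (trigPoly Θ fun n => Complex.I * n * c n) = ∑ l ∈ Finset.range (3 * N),
      fun x => K l • trigPoly Θ c (x + -gridPoint (3 * N) l) := by
    ext x
    simp only [trigPoly, Finset.sum_apply, smul_eq_mul, Finset.mul_sum]
    rw [Finset.sum_comm]
    refine Finset.sum_congr rfl fun n hn => ?_
    rw [hKn n (hΘ n hn), Finset.sum_mul, Finset.sum_mul]
    refine Finset.sum_congr rfl fun l _ => ?_
    rw [fourier_apply_add]
    ring
  have hc := continuous_trigPoly Θ c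
  rw [h1]
  refine (eLpNorm_sum_le (fun l _ => Continuous.aestronglyMeasurable (by fun_prop)) hp).trans ?_
  have h2 : ∀ l ∈ Finset.range (3 * N),
      eLpNorm (fun x => K l • trigPoly Θ c (x + -gridPoint (3 * N) l)) p AddCircle.haarAddCircle =
      ENNReal.ofReal ‖K l‖ * torusNorm p (trigPoly Θ c) := by
    intro l _
    have := eLpNorm_const_smul (K l) (fun x => trigPoly Θ c (x + -gridPoint (3 * N) l)) p
      AddCircle.haarAddCircle
    rw [ofReal_norm, ← torusNorm_comp_add p hc.aestronglyMeasurable (-gridPoint (3 * N) l)]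
    exact this
  rw [Finset.sum_congr rfl h2, ← Finset.sum_mul, ← ENNReal.ofReal_sum_of_nonneg
    fun _ _ => norm_nonneg _]
  gcongr

lemma norm_exp_sub_one_sub_le {u : ℝ} (hu : |u| ≤ 1) :
    ‖Complex.exp ((u : ℂ) * Complex.I) - 1 - u * Complex.I‖ ≤ u ^ 2 := by
  have := Complex.norm_exp_sub_one_sub_id_le (x := (u : ℂ) * Complex.I) (by simpa using hu)
  simpa using this

/-- First order difference of a trigonometric polynomial, estimated by the derivative. -/
lemma torusNorm_translate_sub_le {p : ℝ≥0∞} (hp : 1 ≤ p) (Θ : Finset ℤ) (c : ℤ → ℂ) (h : ℝ) :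
    torusNorm p (fun x => trigPoly Θ c (x + (h : Torus)) - trigPoly Θ c x) ≤
      ENNReal.ofReal |h| * torusNorm p (trigPoly Θ fun n => Complex.I * n * c n) := by
  set P := trigPoly Θ c with hP
  set P' := trigPoly Θ fun n => Complex.I * n * c n with hP'
  have hPc : Continuous P := continuous_trigPoly _ _
  have hPc' : Continuous P' := continuous_trigPoly _ _
  set S : ℝ := ∑ n ∈ Θ, ‖c n‖ * (n : ℝ) ^ 2 with hS
  have hS0 : 0 ≤ S := Finset.sum_nonneg fun n _ => by positivity
  set A := torusNorm p P' with hA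
  obtain ⟨Z, hZ⟩ : ∃ Z : ℝ, ∀ n ∈ Θ, |(n : ℝ)| ≤ Z :=
    ⟨∑ n ∈ Θ, |(n : ℝ)|, fun n hn => Finset.single_le_sum (f := fun n : ℤ => |(n : ℝ)|)
      (fun _ _ => abs_nonneg _) hn⟩
  have hstep : ∀ δ : ℝ, |δ| * Z ≤ 1 → torusNorm p (fun x => P (x + (δ : Torus)) - P x) ≤
      ENNReal.ofReal |δ| * A + ENNReal.ofReal (δ ^ 2 * S) := by
    intro δ hδ
    have h1 : (fun x => P (x + (δ : Torus)) - P x) =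
        (fun x => (δ : ℂ) • P' x) + fun x => P (x + (δ : Torus)) - P x - (δ : ℂ) • P' x := by
      ext x; simp
    rw [h1]
    refine (eLpNorm_add_le (Continuous.aestronglyMeasurable (by fun_prop))
      (Continuous.aestronglyMeasurable (by fun_prop)) hp).trans (add_le_add (le_of_eq ?_) ?_)
    · have := eLpNorm_const_smul (δ : ℂ) P' p AddCircle.haarAddCircle
      rw [hA, torusNorm, ← Real.norm_eq_abs, ← Complex.norm_real, ofReal_norm]
      exact this
    · refine torusNorm_le_of_bound p fun x => ?_
      have h2 : P (x + (δ : Torus)) - P x - (δ : ℂ) • P' x = ∑ n ∈ Θ, c n * fourier n x *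
          (Complex.exp (((n * δ : ℝ) : ℂ) * Complex.I) - 1 - ((n * δ : ℝ) : ℂ) * Complex.I) := by
        simp only [hP, hP', trigPoly, smul_eq_mul, Finset.mul_sum, ← Finset.sum_sub_distrib]
        refine Finset.sum_congr rfl fun n _ => ?_
        rw [fourier_apply_add, fourier_coe_eq]
        push_cast
        ring
      rw [h2]
      refine (norm_sum_le _ _).trans ?_
      rw [hS, Finset.mul_sum]
      refine Finset.sum_le_sum fun n hn => ?_
      rw [norm_mul, norm_mul, norm_fourier_apply, mul_one]
      have h3 : |(n * δ : ℝ)| ≤ 1 := by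
        rw [abs_mul, mul_comm]
        exact (mul_le_mul_of_nonneg_left (hZ n hn) (abs_nonneg δ)).trans hδ
      calc _ ≤ ‖c n‖ * (n * δ : ℝ) ^ 2 :=
            mul_le_mul_of_nonneg_left (norm_exp_sub_one_sub_le h3) (norm_nonneg _)
        _ = _ := by ring
  have hR : ∀ R : ℕ, 0 < R → |h| * Z ≤ R →
      torusNorm p (fun x => P (x + (h : Torus)) - P x) ≤
        ENNReal.ofReal |h| * A + ENNReal.ofReal (h ^ 2 * S / R) := by
    intro R hR hRZ
    have hR' : (0 : ℝ) < R := by exact_mod_cast hR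
    have h1 : (fun x => P (x + (h : Torus)) - P x) = ∑ i ∈ Finset.range R,
        fun x => P (x + ((i * (h / R) : ℝ) : Torus) + ((h / R : ℝ) : Torus)) -
          P (x + ((i * (h / R) : ℝ) : Torus)) := by
      ext x
      rw [Finset.sum_apply]
      have : ∀ i : ℕ, x + ((i * (h / R) : ℝ) : Torus) + ((h / R : ℝ) : Torus) =
          x + (((i + 1 : ℕ) * (h / R) : ℝ) : Torus) := by
        intro i
        rw [add_assoc, ← AddCircle.coe_add]
        congr 3
        push_cast
        ring
      simp only [this]
      rw [Finset.sum_range_sub (fun i : ℕ => P (x + ((i * (h / R) : ℝ) : Torus)))]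
      have h2 : (R : ℝ) * (h / R) = h := by field_simp
      simp [h2]
    rw [h1]
    refine (eLpNorm_sum_le (fun l _ => Continuous.aestronglyMeasurable (by fun_prop)) hp).trans ?_
    have h2 : ∀ i ∈ Finset.range R, eLpNorm (fun x => P (x + ((i * (h / R) : ℝ) : Torus) +
          ((h / R : ℝ) : Torus)) - P (x + ((i * (h / R) : ℝ) : Torus))) p AddCircle.haarAddCircle ≤
        ENNReal.ofReal |h / R| * A + ENNReal.ofReal ((h / R) ^ 2 * S) := by
      intro i _
      refine le_trans (le_of_eq ?_) (hstep (h / R) ?_)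
      · exact torusNorm_comp_add p (f := fun x => P (x + ((h / R : ℝ) : Torus)) - P x)
          (Continuous.aestronglyMeasurable (by fun_prop)) _
      · rw [abs_div, abs_of_pos hR', div_mul_eq_mul_div, div_le_one hR']
        exact hRZ
    refine (Finset.sum_le_sum h2).trans (le_of_eq ?_)
    rw [Finset.sum_const, Finset.card_range, nsmul_eq_mul, mul_add, ← mul_assoc,
      ← ENNReal.ofReal_natCast, ← ENNReal.ofReal_mul hR'.le, ← ENNReal.ofReal_mul hR'.le, abs_div,
      abs_of_pos hR', mul_div_cancel₀ _ hR'.ne']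
    congr 2
    field_simp
  have hlim : Filter.Tendsto (fun R : ℕ => ENNReal.ofReal |h| * A + ENNReal.ofReal (h ^ 2 * S / R))
      Filter.atTop (nhds (ENNReal.ofReal |h| * A + ENNReal.ofReal 0)) := by
    refine Filter.Tendsto.const_add _ (ENNReal.tendsto_ofReal ?_)
    exact tendsto_const_div_atTop_nhds_zero_nat _
  rw [ENNReal.ofReal_zero, add_zero] at hlim
  refine ge_of_tendsto hlim ?_
  filter_upwards [Filter.eventually_gt_atTop 0,
    tendsto_natCast_atTop_atTop.eventually_ge_atTop (|h| * Z)] with R h1 h2 using hR R h1 h2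

/-- Bernstein's inequality for first differences. -/
lemma torusNorm_translate_sub_le_degree {p : ℝ≥0∞} (hp : 1 ≤ p) {N : ℕ} (hN : 0 < N)
    (Θ : Finset ℤ) (hΘ : ∀ n ∈ Θ, n.natAbs ≤ N) (c : ℤ → ℂ) (h : ℝ) :
    torusNorm p (fun x => trigPoly Θ c (x + (h : Torus)) - trigPoly Θ c x) ≤
      ENNReal.ofReal (2 * N * |h|) * torusNorm p (trigPoly Θ c) := by
  refine (torusNorm_translate_sub_le hp Θ c h).trans ?_
  rw [mul_comm (2 * (N : ℝ)), ENNReal.ofReal_mul (abs_nonneg _), mul_assoc]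
  gcongr
  exact torusNorm_deriv_le hp hN Θ hΘ c

/-- The sup norm of a trigonometric polynomial of degree at most `N` is controlled by its values
at `26 N` equidistant nodes. -/
lemma norm_trigPoly_le_of_gridPoint {N : ℕ} (hN : 0 < N) (Θ : Finset ℤ)
    (hΘ : ∀ n ∈ Θ, n.natAbs ≤ N) (c : ℤ → ℂ) {ε : ℝ}
    (hε : ∀ l < 26 * N, ‖trigPoly Θ c (gridPoint (26 * N) l)‖ ≤ ε) (x : Torus) :
    ‖trigPoly Θ c x‖ ≤ 2 * ε := by
  have hc := continuous_trigPoly Θ c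
  obtain ⟨z, -, hz⟩ := isCompact_univ.exists_isMaxOn (f := fun x => ‖trigPoly Θ c x‖)
    ⟨(0 : Torus), Set.mem_univ _⟩ hc.norm.continuousOn
  have hz : ∀ x, ‖trigPoly Θ c x‖ ≤ ‖trigPoly Θ c z‖ := fun x => hz (Set.mem_univ x)
  refine (hz x).trans ?_
  set B := ‖trigPoly Θ c z‖
  have hN' : (0 : ℝ) < N := by exact_mod_cast hN
  have hL : (0 : ℝ) < ((26 * N : ℕ) : ℝ) := by positivity
  obtain ⟨l, s, hl, hs, hzl⟩ : ∃ (l : ℕ) (s : ℝ), l < 26 * N ∧ |s| ≤ 2 * Real.pi / (26 * N : ℕ) ∧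
      z = gridPoint (26 * N) l + (s : Torus) := by
    obtain ⟨y, hy, rfl⟩ := AddCircle.eq_coe_Ico z
    set L : ℝ := ((26 * N : ℕ) : ℝ)
    have hpi := Real.two_pi_pos
    set τ := y * L / (2 * Real.pi) with hτ
    have hτ0 : 0 ≤ τ := by have := hy.1; positivity
    have hfl := Nat.floor_le hτ0
    have hfl2 := Nat.lt_floor_add_one τ
    refine ⟨⌊τ⌋₊, y - 2 * Real.pi * ⌊τ⌋₊ / L, ?_, ?_, ?_⟩
    · rw [Nat.floor_lt hτ0, hτ, div_lt_iff₀ hpi, mul_comm]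
      exact mul_lt_mul_of_pos_left hy.2 hL
    · have h1 : y - 2 * Real.pi * ⌊τ⌋₊ / L = 2 * Real.pi / L * (τ - ⌊τ⌋₊) := by
        rw [hτ]; field_simp
      rw [h1, abs_mul, abs_of_pos (by positivity)]
      have : |τ - ⌊τ⌋₊| ≤ 1 := abs_le.2 ⟨by linarith, by linarith⟩
      exact mul_le_of_le_one_right (by positivity) this
    · rw [gridPoint, ← AddCircle.coe_add]
      congr 1
      ring
  have hB : torusNorm ∞ (trigPoly Θ c) ≤ ENNReal.ofReal B := torusNorm_le_of_bound _ hz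
  have h1 := (torusNorm_translate_sub_le_degree (p := ∞) le_top hN Θ hΘ c s).trans
    (mul_le_mul_right hB _)
  rw [← ENNReal.ofReal_mul (by positivity)] at h1
  have hB0 : 0 ≤ B := norm_nonneg _
  have h2 := norm_le_of_torusNorm_top (by fun_prop) (by positivity) h1 (gridPoint (26 * N) l)
  rw [← hzl] at h2
  have h3 := norm_sub_norm_le (trigPoly Θ c z) (trigPoly Θ c (gridPoint (26 * N) l))
  have h4 := hε l hl
  have h5 : 2 * N * |s| * B ≤ B / 2 := by
    have : 2 * N * |s| ≤ 1 / 2 := by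
      calc 2 * N * |s| ≤ 2 * N * (2 * Real.pi / (26 * N : ℕ)) := by gcongr
        _ = 4 * Real.pi / 26 := by push_cast; field_simp; ring
        _ ≤ 1 / 2 := by linarith [Real.pi_lt_d2]
    nlinarith
  change B - _ ≤ _ at h3
  linarith

end Basics

section SparsePoly

lemma norm_trigPoly_le (Θ : Finset ℤ) (c : ℤ → ℂ) (x : Torus) :
    ‖trigPoly Θ c x‖ ≤ ∑ n ∈ Θ, ‖c n‖ := by
  refine (norm_sum_le _ _).trans (le_of_eq ?_)
  exact Finset.sum_congr rfl fun n _ => by rw [norm_mul, norm_fourier_apply, mul_one]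

/-- The absolute constant in the sparsification of trigonometric polynomials. -/
def sparseConst : ℝ := 4 * Real.log (2 * (4 * Real.exp 4 * 52)) + 2

lemma log_sparse_nonneg : 0 ≤ Real.log (2 * (4 * Real.exp 4 * 52)) := by
  refine Real.log_nonneg ?_
  have := Real.one_le_exp (show (0 : ℝ) ≤ 4 by norm_num)
  linarith

lemma sparseConst_pos : 0 < sparseConst := by
  have := log_sparse_nonneg
  unfold sparseConst; linarith

/-- A trigonometric polynomial of degree at most `N` with absolute sum of coefficients at most `A`
is within `A μ^{-1/2} (4 Λ + C)` of one with at most `2 μ` terms, where `exp Λ ≥ N / μ`. -/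
theorem exists_sparse_trigPoly {N : ℕ} (hN : 0 < N) (Θ : Finset ℤ)
    (hΘ : ∀ n ∈ Θ, n.natAbs ≤ N) (c : ℤ → ℂ) {A : ℝ} (hA : 0 < A) (hcA : ∑ n ∈ Θ, ‖c n‖ ≤ A)
    {μ : ℝ} (hμ : 0 < μ) {Λ : ℝ} (hΛ : 0 ≤ Λ) (hNμ : N / μ ≤ Real.exp Λ) :
    ∃ d : ℤ → ℂ, (∀ n ∉ Θ, d n = 0) ∧ ((Θ.filter fun n => d n ≠ 0).card : ℝ) ≤ 2 * μ ∧
      ∀ x, ‖trigPoly Θ (fun n => c n - d n) x‖ ≤ A / √μ * (4 * Λ + sparseConst) := by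
  classical
  have hsμ : 0 < √μ := Real.sqrt_pos.2 hμ
  by_cases hμ4 : μ < 4
  · refine ⟨fun _ => 0, fun _ _ => rfl, by simpa using hμ.le, fun x => ?_⟩
    simp only [sub_zero]
    refine (norm_trigPoly_le Θ c x).trans (hcA.trans ?_)
    have h1 : √μ ≤ 2 := by rw [Real.sqrt_le_left (by norm_num)]; linarith
    have h2 : 2 ≤ 4 * Λ + sparseConst := by
      have := log_sparse_nonneg
      unfold sparseConst; linarith
    rw [div_mul_eq_mul_div, le_div_iff₀ hsμ]
    nlinarith
  rw [not_lt] at hμ4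
  let ph : ℤ → ℂ := fun n => c n / ‖c n‖
  have hph : ∀ n, ‖ph n‖ ≤ 1 := fun n => by
    simp only [ph, norm_div, Complex.norm_real, norm_norm]
    exact div_self_le_one _
  have hcph : ∀ n, c n = ‖c n‖ * ph n := fun n => by
    by_cases h : c n = 0
    · simp [h]
    · have : (‖c n‖ : ℂ) ≠ 0 := by simpa using h
      simp only [ph]; field_simp
  let z : Fin (26 * N) → Θ → ℂ := fun l n => ph n * fourier (n : ℤ) (gridPoint (26 * N) l)
  have hz : ∀ l n, ‖z l n‖ ≤ 1 := fun l n => by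
    simp only [z, norm_mul, norm_fourier_apply, mul_one]; exact hph n
  let v : Fin (26 * N) ⊕ Fin (26 * N) → Θ → ℝ :=
    Sum.elim (fun l n => (z l n).re) (fun l n => (z l n).im)
  set T := Λ + Real.log (2 * (4 * Real.exp 4 * 52)) with hT
  have hT0 : 0 ≤ T := add_nonneg hΛ log_sparse_nonneg
  obtain ⟨b, hb0, hb⟩ := exists_sparse_nonneg v (by
      rintro (l | l) n
      · exact (Complex.abs_re_le_norm _).trans (hz l n)
      · exact (Complex.abs_im_le_norm _).trans (hz l n))
    (fun n : Θ => ‖c n‖) (fun _ => norm_nonneg _) hA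
    (by rw [Finset.sum_coe_sort Θ (fun n => ‖c n‖)]; exact hcA) hμ4 hT0 (by
      have h1 : Real.exp T = Real.exp Λ * (2 * (4 * Real.exp 4 * 52)) := by
        rw [hT, Real.exp_add, Real.exp_log (by positivity)]
      have h2 : Real.exp T / 2 ≤ Real.cosh T := by
        rw [Real.cosh_eq]; linarith [Real.exp_pos (-T)]
      rw [div_le_iff₀ hμ] at hNμ
      have h3 : (Fintype.card (Fin (26 * N) ⊕ Fin (26 * N)) : ℝ) = 52 * N := by
        simp; ring
      rw [h3]
      calc 4 * Real.exp 4 * (52 * N) ≤ 4 * Real.exp 4 * (52 * (Real.exp Λ * μ)) := by gcongr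
        _ = μ * (Real.exp T / 2) := by rw [h1]; ring
        _ ≤ _ := mul_le_mul_of_nonneg_left h2 hμ.le)
  let d : ℤ → ℂ := fun n => if h : n ∈ Θ then b ⟨n, h⟩ * ph n else 0
  have hd : ∀ n : Θ, d n = b n * ph n := fun n => by simp [d]
  refine ⟨d, fun n hn => by simp [d, hn], ?_, ?_⟩
  · refine le_trans ?_ hb0
    have : (Θ.filter fun n => d n ≠ 0) ⊆
        (Finset.univ.filter fun i => b i ≠ 0).image (Subtype.val : Θ → ℤ) := by
      intro n hn
      obtain ⟨h1, h2⟩ := Finset.mem_filter.1 hn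
      refine Finset.mem_image.2 ⟨⟨n, h1⟩, ?_, rfl⟩
      simp only [Finset.mem_filter, Finset.mem_univ, true_and]
      intro h3
      exact h2 (by simp [d, h1, h3])
    exact_mod_cast (Finset.card_le_card this).trans Finset.card_image_le
  · intro x
    have hgrid : ∀ l < 26 * N, ‖trigPoly Θ (fun n => c n - d n) (gridPoint (26 * N) l)‖ ≤
        2 * (A / √μ * T) := by
      intro l hl
      set w := trigPoly Θ (fun n => c n - d n) (gridPoint (26 * N) l)
      have hw : w = -∑ n : Θ, ((b n - ‖c n‖ : ℝ) : ℂ) * z ⟨l, hl⟩ n := by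
        simp only [w, trigPoly]
        rw [← Finset.sum_coe_sort, ← Finset.sum_neg_distrib]
        refine Finset.sum_congr rfl fun n _ => ?_
        rw [hd]
        simp only [z]
        push_cast
        linear_combination fourier (n : ℤ) (gridPoint (26 * N) l) * hcph n
      have hre : |w.re| ≤ A / √μ * T := by
        have := hb (Sum.inl ⟨l, hl⟩)
        rw [hw, Complex.neg_re, abs_neg, Complex.re_sum]
        simp only [Complex.re_ofReal_mul]
        exact this
      have him : |w.im| ≤ A / √μ * T := by
        have := hb (Sum.inr ⟨l, hl⟩)
        rw [hw, Complex.neg_im, abs_neg, Complex.im_sum]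
        simp only [Complex.im_ofReal_mul]
        exact this
      have := Complex.norm_le_abs_re_add_abs_im w
      linarith
    refine (norm_trigPoly_le_of_gridPoint hN Θ hΘ _ hgrid x).trans ?_
    rw [sparseConst]
    have : 0 ≤ A / √μ := by positivity
    nlinarith

end SparsePoly

section Multipliers

lemma integrable_of_continuous {f : Torus → ℂ} (hf : Continuous f) :
    Integrable f AddCircle.haarAddCircle :=
  hf.integrable_of_hasCompactSupport (HasCompactSupport.of_compactSpace f)

lemma fourierCoeff_trigPoly (Θ : Finset ℤ) (c : ℤ → ℂ) (n : ℤ) :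
    fourierCoeff (trigPoly Θ c) n = if n ∈ Θ then c n else 0 := by
  have h1 : trigPoly Θ c = fun x => ∑ m ∈ Θ, c m * fourier m x := rfl
  have h2 : ∀ x, fourier (-n) x • trigPoly Θ c x = ∑ m ∈ Θ, c m * fourier (m - n) x := by
    intro x
    rw [h1, smul_eq_mul, Finset.mul_sum]
    refine Finset.sum_congr rfl fun m _ => ?_
    rw [sub_eq_neg_add, fourier_add]; ring
  rw [fourierCoeff]
  simp only [h2]
  rw [integral_finsetSum _ fun m _ => integrable_of_continuous (by fun_prop)]
  simp only [integral_const_mul, integral_fourier, mul_ite, mul_one, mul_zero, sub_eq_zero]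
  rw [Finset.sum_ite_eq' Θ n]

/-- The Fourier coefficients of the de la Vallée-Poussin kernel. -/
def vpCoeff (l : ℕ) (n : ℤ) : ℂ := (l : ℂ)⁻¹ * (((2 * l - n.natAbs : ℕ) : ℂ) - (l - n.natAbs : ℕ))

lemma fejerSum_eq_sum (N : ℕ) {L : ℕ} (hL : N ≤ L) (x : Torus) :
    fejerSum N x = ∑ n ∈ Finset.Icc (-(L : ℤ)) L, ((N - n.natAbs : ℕ) : ℂ) * fourier n x := by
  have h1 : ∀ j ∈ Finset.range N, dirichletKernel j x =
      ∑ n ∈ Finset.Icc (-(L : ℤ)) L, if n.natAbs ≤ j then fourier n x else 0 := by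
    intro j hj
    have := Finset.mem_range.1 hj
    rw [← Finset.sum_filter, dirichletKernel]
    refine Finset.sum_congr ?_ fun _ _ => rfl
    ext n
    simp only [Finset.mem_Icc, Finset.mem_filter]
    omega
  rw [fejerSum, Finset.sum_congr rfl h1, Finset.sum_comm]
  refine Finset.sum_congr rfl fun n _ => ?_
  rw [← Finset.sum_filter, Finset.sum_const, card_filter_natAbs_le, nsmul_eq_mul]

lemma vpKernel_eq_fejerSum (l : ℕ) (x : Torus) :
    vpKernel l x = (l : ℂ)⁻¹ * (fejerSum (2 * l) x - fejerSum l x) := by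
  rcases Nat.eq_zero_or_pos l with rfl | hl
  · simp [vpKernel]
  have : Finset.Icc l (2 * l - 1) = Finset.Ico l (2 * l) := by
    ext; simp; omega
  rw [vpKernel, this, Finset.sum_Ico_eq_sub _ (by omega)]
  rfl

lemma vpKernel_eq_sum (l : ℕ) (x : Torus) :
    vpKernel l x = ∑ n ∈ Finset.Icc (-((2 * l : ℕ) : ℤ)) (2 * l : ℕ), vpCoeff l n * fourier n x := by
  rw [vpKernel_eq_fejerSum, fejerSum_eq_sum (2 * l) le_rfl,
    fejerSum_eq_sum l (show l ≤ 2 * l by omega), ← Finset.sum_sub_distrib, Finset.mul_sum]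
  refine Finset.sum_congr rfl fun n _ => ?_
  rw [vpCoeff]; ring

lemma vpSum_eq_trigPoly (l : ℕ) {f : Torus → ℂ} (hf : Integrable f AddCircle.haarAddCircle) :
    vpSum l f = trigPoly (Finset.Icc (-((2 * l : ℕ) : ℤ)) (2 * l : ℕ))
      (fun n => vpCoeff l n * fourierCoeff f n) := by
  ext x
  have h1 : ∀ t, f t * vpKernel l (x - t) = ∑ n ∈ Finset.Icc (-((2 * l : ℕ) : ℤ)) (2 * l : ℕ),
      (vpCoeff l n * fourier n x) * (fourier (-n) t • f t) := by
    intro t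
    rw [vpKernel_eq_sum, Finset.mul_sum]
    refine Finset.sum_congr rfl fun n _ => ?_
    rw [sub_eq_add_neg, fourier_apply_add, fourier_apply_neg, smul_eq_mul]; ring
  rw [vpSum]
  simp only [h1]
  rw [integral_finsetSum _ fun n _ => (hf.fourier_smul (-n)).const_mul _]
  simp only [integral_const_mul, trigPoly, fourierCoeff]
  exact Finset.sum_congr rfl fun n _ => by ring

lemma integral_norm_fejerSum (N : ℕ) (x : Torus) :
    ∫ t, ‖fejerSum N (x - t)‖ ∂AddCircle.haarAddCircle = N := by
  have h1 : ∫ t, fejerSum N (x - t) ∂AddCircle.haarAddCircle = N := by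
    rw [integral_sub_left_eq_self (fun t => fejerSum N t)]
    simp only [fejerSum, dirichletKernel]
    rw [integral_finsetSum _ fun m _ => integrable_of_continuous (by fun_prop)]
    have : ∀ j ∈ Finset.range N, ∫ a : Torus, ∑ m ∈ Finset.Icc (-(j : ℤ)) j, fourier m a
        ∂AddCircle.haarAddCircle = 1 := by
      intro j _
      rw [integral_finsetSum _ fun m _ => integrable_of_continuous (by fun_prop)]
      simp only [integral_fourier]
      rw [Finset.sum_ite_eq']
      simp
    rw [Finset.sum_congr rfl this]
    simp
  have h2 : ((∫ t, ‖fejerSum N (x - t)‖ ∂AddCircle.haarAddCircle : ℝ) : ℂ) = N := by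
    rw [← integral_complex_ofReal, ← h1]
    exact integral_congr_ae (Filter.Eventually.of_forall fun t => (fejerSum_eq_norm N _).symm)
  exact_mod_cast h2

lemma continuous_fejerSum (N : ℕ) : Continuous (fejerSum N) := by
  unfold fejerSum dirichletKernel; fun_prop

/-- The de la Vallée-Poussin sums are bounded by three times the sup norm. -/
lemma norm_vpSum_le {l : ℕ} (hl : 0 < l) {f : Torus → ℂ} {B : ℝ} (hB : ∀ x, ‖f x‖ ≤ B)
    (x : Torus) : ‖vpSum l f x‖ ≤ 3 * B := by
  have hB0 : 0 ≤ B := (norm_nonneg _).trans (hB 0)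
  have hl' : (0 : ℝ) < l := by exact_mod_cast hl
  have hi : ∀ N, Integrable (fun t => ‖fejerSum N (x - t)‖)
      (AddCircle.haarAddCircle (T := 2 * Real.pi)) := fun N =>
    (integrable_of_continuous (f := fun t => fejerSum N (x - t))
      ((continuous_fejerSum N).comp (by fun_prop))).norm
  calc ‖vpSum l f x‖ ≤ ∫ t, B * ((l : ℝ)⁻¹ * (‖fejerSum (2 * l) (x - t)‖ + ‖fejerSum l (x - t)‖))
        ∂AddCircle.haarAddCircle := by
        refine norm_integral_le_of_norm_le ((((hi _).add (hi _)).const_mul _).const_mul _) ?_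
        refine Filter.Eventually.of_forall fun t => ?_
        rw [norm_mul, vpKernel_eq_fejerSum, norm_mul, norm_inv, Complex.norm_natCast]
        exact mul_le_mul (hB t) (mul_le_mul_of_nonneg_left (norm_sub_le _ _) (by positivity))
          (by positivity) hB0
    _ = 3 * B := by
        rw [integral_const_mul, integral_const_mul, integral_add (hi _) (hi _),
          integral_norm_fejerSum, integral_norm_fejerSum]
        push_cast
        field_simp
        ring

/-- The Fourier multiplier of the dyadic block `σ_s`. -/
def sigmaCoeff : ℕ → ℤ → ℂ
  | 0, n => vpCoeff 1 n
  | s + 1, n => vpCoeff (2 ^ (s + 1)) n - vpCoeff (2 ^ s) n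

/-- The frequencies `n` with `2^(j-1) ≤ |n| < 2^j`. -/
def dyadicBlock (j : ℕ) : Finset ℤ :=
  (Finset.Icc (-(2 ^ j : ℕ) : ℤ) (2 ^ j : ℕ)).filter fun n => n.natAbs.size = j

lemma mem_dyadicBlock {j : ℕ} {n : ℤ} : n ∈ dyadicBlock j ↔ n.natAbs.size = j := by
  simp only [dyadicBlock, Finset.mem_filter, Finset.mem_Icc, and_iff_right_iff_imp]
  rintro rfl
  have := Nat.lt_size_self n.natAbs
  omega

lemma natAbs_lt_of_mem_dyadicBlock {j : ℕ} {n : ℤ} (h : n ∈ dyadicBlock j) : n.natAbs < 2 ^ j := by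
  rw [← mem_dyadicBlock.1 h]; exact Nat.lt_size_self _

lemma card_dyadicBlock_le (j : ℕ) : (dyadicBlock j).card ≤ 3 * 2 ^ j := by
  refine (Finset.card_filter_le _ _).trans ?_
  rw [Int.card_Icc]
  have : 1 ≤ 2 ^ j := Nat.one_le_two_pow
  omega

lemma vpCoeff_eq_one {l : ℕ} (hl : 0 < l) {n : ℤ} (hn : n.natAbs ≤ l) : vpCoeff l n = 1 := by
  have : (l : ℂ) ≠ 0 := by exact_mod_cast hl.ne'
  rw [vpCoeff, Nat.cast_sub (by omega), Nat.cast_sub hn]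
  push_cast
  field_simp
  ring

lemma vpCoeff_eq_zero {l : ℕ} {n : ℤ} (hn : 2 * l ≤ n.natAbs) : vpCoeff l n = 0 := by
  rw [vpCoeff, Nat.sub_eq_zero_of_le hn, Nat.sub_eq_zero_of_le (by omega)]
  simp

lemma sigmaCoeff_eq_zero {s : ℕ} {n : ℤ} (h1 : n.natAbs.size ≠ s) (h2 : n.natAbs.size ≠ s + 1) :
    sigmaCoeff s n = 0 := by
  cases s with
  | zero =>
    refine vpCoeff_eq_zero ?_
    by_contra h
    have : n.natAbs.size ≤ 1 := Nat.size_le.2 (by omega)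
    omega
  | succ s =>
    rw [sigmaCoeff]
    rcases lt_or_gt_of_ne h1 with h | h
    · have h3 : n.natAbs < 2 ^ s := Nat.size_le.1 (by omega)
      have h4 : 2 ^ (s + 1) = 2 * 2 ^ s := by ring
      rw [vpCoeff_eq_one (by positivity) (by omega), vpCoeff_eq_one (by positivity) h3.le, sub_self]
    · have h3 : 2 ^ (s + 2) ≤ n.natAbs := Nat.lt_size.1 (by omega)
      have h4 : 2 ^ (s + 1) = 2 * 2 ^ s := by ring
      have h5 : 2 ^ (s + 2) = 4 * 2 ^ s := by ring
      rw [vpCoeff_eq_zero (by omega), vpCoeff_eq_zero (by omega), sub_self]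

lemma trigPoly_subset {Θ Θ' : Finset ℤ} (h : Θ ⊆ Θ') (c : ℤ → ℂ) (hc : ∀ n ∈ Θ', n ∉ Θ → c n = 0) :
    trigPoly Θ' c = trigPoly Θ c := by
  ext x
  exact (Finset.sum_subset h fun n h1 h2 => by rw [hc n h1 h2, zero_mul]).symm

lemma sigmaBlock_eq_trigPoly (s : ℕ) {f : Torus → ℂ}
    (hf : Integrable f AddCircle.haarAddCircle) :
    sigmaBlock s f = trigPoly (Finset.Icc (-((2 * 2 ^ s : ℕ) : ℤ)) (2 * 2 ^ s : ℕ))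
      (fun n => sigmaCoeff s n * fourierCoeff f n) := by
  cases s with
  | zero => exact vpSum_eq_trigPoly 1 hf
  | succ s =>
    have h1 := vpSum_eq_trigPoly (2 ^ s) hf
    have h2 : trigPoly (Finset.Icc (-((2 * 2 ^ (s + 1) : ℕ) : ℤ)) (2 * 2 ^ (s + 1) : ℕ))
        (fun n => vpCoeff (2 ^ s) n * fourierCoeff f n) = trigPoly
        (Finset.Icc (-((2 * 2 ^ s : ℕ) : ℤ)) (2 * 2 ^ s : ℕ))
        (fun n => vpCoeff (2 ^ s) n * fourierCoeff f n) := by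
      refine trigPoly_subset ?_ _ fun n h1 h2 => ?_
      · have : 2 * 2 ^ s ≤ 2 * 2 ^ (s + 1) := by rw [pow_succ]; omega
        exact Finset.Icc_subset_Icc (by omega) (by omega)
      · rw [vpCoeff_eq_zero, zero_mul]
        simp only [Finset.mem_Icc, not_and_or] at h2
        omega
    ext x
    simp only [sigmaBlock]
    rw [h1, ← h2, vpSum_eq_trigPoly _ hf]
    simp only [trigPoly, sigmaCoeff, ← Finset.sum_sub_distrib]
    exact Finset.sum_congr rfl fun n _ => by ring

lemma norm_sigmaBlock_le (s : ℕ) {f : Torus → ℂ} {B : ℝ} (hB : ∀ x, ‖f x‖ ≤ B) (x : Torus) :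
    ‖sigmaBlock s f x‖ ≤ 6 * B := by
  have hB0 : 0 ≤ B := (norm_nonneg _).trans (hB 0)
  cases s with
  | zero => exact (norm_vpSum_le one_pos hB x).trans (by linarith)
  | succ s =>
    refine (norm_sub_le _ _).trans ?_
    have h1 := norm_vpSum_le (l := 2 ^ (s + 1)) (by positivity) hB x
    have h2 := norm_vpSum_le (l := 2 ^ s) (by positivity) hB x
    linarith

lemma torusNorm_sigmaBlock_le {f : Torus → ℂ} (hf : Integrable f AddCircle.haarAddCircle)
    {ε : ℕ → ℝ} (hε : ∀ j x, ‖trigPoly (dyadicBlock j) (fourierCoeff f) x‖ ≤ ε j) (s : ℕ) :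
    torusNorm ∞ (sigmaBlock s f) ≤ ENNReal.ofReal (6 * (ε s + ε (s + 1))) := by
  set P := trigPoly (dyadicBlock s ∪ dyadicBlock (s + 1)) (fourierCoeff f) with hP
  have hdisj : Disjoint (dyadicBlock s) (dyadicBlock (s + 1)) := by
    rw [Finset.disjoint_left]
    intro n h1 h2
    rw [mem_dyadicBlock] at h1 h2
    omega
  have hPB : ∀ x, ‖P x‖ ≤ ε s + ε (s + 1) := by
    intro x
    have : P x = trigPoly (dyadicBlock s) (fourierCoeff f) x +
        trigPoly (dyadicBlock (s + 1)) (fourierCoeff f) x := Finset.sum_union hdisj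
    rw [this]
    exact (norm_add_le _ _).trans (add_le_add (hε _ _) (hε _ _))
  have hfP : sigmaBlock s f = sigmaBlock s P := by
    rw [sigmaBlock_eq_trigPoly s hf, sigmaBlock_eq_trigPoly s
      (integrable_of_continuous (continuous_trigPoly _ _))]
    congr 1
    ext n
    rw [fourierCoeff_trigPoly]
    split_ifs with h
    · rfl
    · rw [Finset.mem_union, mem_dyadicBlock, mem_dyadicBlock, not_or] at h
      rw [sigmaCoeff_eq_zero h.1 h.2, zero_mul, zero_mul]
  rw [hfP]
  exact torusNorm_le_of_bound _ (norm_sigmaBlock_le s hPB)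

/-- The norm of `B_{∞,1}` is controlled by the sup norms of the sharp dyadic blocks. -/
theorem bqOneNorm_le_tsum {f : Torus → ℂ} (hf : Integrable f AddCircle.haarAddCircle)
    {ε : ℕ → ℝ} (hε : ∀ j x, ‖trigPoly (dyadicBlock j) (fourierCoeff f) x‖ ≤ ε j)
    (hs : Summable ε) : bqOneNorm ∞ f ≤ ENNReal.ofReal (12 * ∑' j, ε j) := by
  have hε0 : ∀ j, 0 ≤ ε j := fun j => (norm_nonneg _).trans (hε j 0)
  have hs1 : Summable fun s => ε (s + 1) := (summable_nat_add_iff 1).2 hs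
  refine (ENNReal.tsum_le_tsum (torusNorm_sigmaBlock_le hf hε)).trans ?_
  rw [← ENNReal.ofReal_tsum_of_nonneg (fun s => by have := hε0 s; have := hε0 (s + 1); positivity)
    ((hs.add hs1).mul_left 6)]
  refine ENNReal.ofReal_le_ofReal ?_
  rw [tsum_mul_left, hs.tsum_add hs1]
  have := hs.sum_add_tsum_nat_add 1
  rw [Finset.sum_range_one] at this
  have := hε0 0
  linarith

end Multipliers

section Uniqueness

/-- Integration of continuous functions against an integrable function. -/
def integralCLM {u : Torus → ℂ} (hu : Integrable u AddCircle.haarAddCircle) :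
    C(Torus, ℂ) →L[ℂ] ℂ :=
  have hi : ∀ φ : C(Torus, ℂ), Integrable (fun t => φ t * u t) AddCircle.haarAddCircle := fun φ =>
    hu.bdd_mul φ.continuous.aestronglyMeasurable
      (Filter.Eventually.of_forall fun t => φ.norm_coe_le_norm t)
  LinearMap.mkContinuous
    { toFun := fun φ => ∫ t, φ t * u t ∂AddCircle.haarAddCircle
      map_add' := fun φ ψ => by
        simp only [ContinuousMap.add_apply, add_mul]
        exact integral_add (hi φ) (hi ψ)
      map_smul' := fun c φ => by
        simp only [ContinuousMap.smul_apply, smul_eq_mul, mul_assoc, RingHom.id_apply]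
        exact integral_const_mul c _ }
    (∫ t, ‖u t‖ ∂AddCircle.haarAddCircle) fun φ => by
      refine (norm_integral_le_of_norm_le (hu.norm.const_mul ‖φ‖)
        (Filter.Eventually.of_forall fun t => ?_)).trans_eq ?_
      · rw [norm_mul]
        exact mul_le_mul_of_nonneg_right (φ.norm_coe_le_norm t) (norm_nonneg _)
      · rw [integral_const_mul, mul_comm]

lemma integralCLM_apply {u : Torus → ℂ} (hu : Integrable u AddCircle.haarAddCircle)
    (φ : C(Torus, ℂ)) : integralCLM hu φ = ∫ t, φ t * u t ∂AddCircle.haarAddCircle := rfl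

/-- An integrable function with vanishing Fourier coefficients vanishes almost everywhere. -/
theorem ae_eq_zero_of_fourierCoeff_eq_zero {u : Torus → ℂ}
    (hu : Integrable u AddCircle.haarAddCircle) (h : ∀ n, fourierCoeff u n = 0) :
    u =ᵐ[AddCircle.haarAddCircle] 0 := by
  have hzero : integralCLM hu = 0 := by
    refine ContinuousLinearMap.ext_on (s := Set.range (fourier (T := 2 * Real.pi))) ?_ ?_
    · rw [Submodule.dense_iff_topologicalClosure_eq_top]
      exact span_fourier_closure_eq_top
    · rintro _ ⟨n, rfl⟩
      have := h (-n)
      rw [fourierCoeff, neg_neg] at this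
      exact this
  refine ae_eq_zero_of_forall_setIntegral_isClosed_eq_zero hu fun s hs => ?_
  have h1 : ∀ n, ∫ t, ((hs.apprSeq n t : ℝ) : ℂ) * u t ∂AddCircle.haarAddCircle = 0 := by
    intro n
    have := integralCLM_apply hu ⟨fun t => ((hs.apprSeq n t : ℝ) : ℂ), by fun_prop⟩
    rw [hzero] at this
    exact this.symm
  have h2 : Filter.Tendsto (fun n => ∫ t, ((hs.apprSeq n t : ℝ) : ℂ) * u t
      ∂AddCircle.haarAddCircle) Filter.atTop
      (nhds (∫ t, s.indicator u t ∂AddCircle.haarAddCircle)) := by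
    refine tendsto_integral_of_dominated_convergence (fun t => ‖u t‖) (fun n => ?_) hu.norm
      (fun n => Filter.Eventually.of_forall fun t => ?_) (Filter.Eventually.of_forall fun t => ?_)
    · exact (Continuous.aestronglyMeasurable (by fun_prop)).mul hu.aestronglyMeasurable
    · rw [norm_mul, Complex.norm_real]
      refine mul_le_of_le_one_left (norm_nonneg _) ?_
      rw [Real.norm_of_nonneg (NNReal.coe_nonneg _)]
      exact_mod_cast HasOuterApproxClosed.apprSeq_apply_le_one hs n t
    · have h3 := (tendsto_pi_nhds.1 (HasOuterApproxClosed.tendsto_apprSeq hs)) t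
      have h4 : Filter.Tendsto (fun n => ((hs.apprSeq n t : ℝ) : ℂ) * u t) Filter.atTop
          (nhds ((((s.indicator (fun _ => (1 : NNReal)) t : NNReal) : ℝ) : ℂ) * u t)) := by
        refine Filter.Tendsto.mul_const _ ?_
        exact (Complex.continuous_ofReal.tendsto _).comp
          ((NNReal.continuous_coe.tendsto _).comp h3)
      convert h4 using 2
      by_cases ht : t ∈ s <;> simp [ht]
  simp only [h1] at h2
  rw [integral_indicator hs.measurableSet] at h2
  exact (tendsto_nhds_unique h2 tendsto_const_nhds)

/-- An integrable function with absolutely summable Fourier coefficients is essentially bounded. -/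
theorem memLp_top_of_summable_fourierCoeff {f : Torus → ℂ}
    (hf : Integrable f AddCircle.haarAddCircle) (hs : Summable fun n => ‖fourierCoeff f n‖) :
    InLp ∞ f := by
  have hs' : Summable fun n : ℤ => fourierCoeff f n • (fourier n : C(Torus, ℂ)) := by
    refine Summable.of_norm ?_
    simpa only [norm_smul, fourier_norm, mul_one] using hs
  set g : C(Torus, ℂ) := ∑' n : ℤ, fourierCoeff f n • fourier n with hg
  have hcoeff : ∀ n, fourierCoeff g n = fourierCoeff f n := by
    intro n
    have hi : Integrable (fun t : Torus => fourier (-n) t) AddCircle.haarAddCircle :=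
      integrable_of_continuous (by fun_prop)
    have h1 : fourierCoeff g n = integralCLM hi g := by
      rw [integralCLM_apply, fourierCoeff]
      simp only [smul_eq_mul, mul_comm]
    rw [h1, hg, ContinuousLinearMap.map_tsum _ hs', tsum_eq_single n]
    · rw [map_smul, integralCLM_apply]
      have : ∀ t : Torus, fourier n t * fourier (-n) t = 1 := fun t => by
        rw [← fourier_add, add_neg_cancel, fourier_zero_apply]
      simp only [this]
      simp
    · intro m hm
      rw [map_smul, integralCLM_apply]
      have : ∀ t : Torus, fourier m t * fourier (-n) t = fourier (m - n) t := fun t => by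
        rw [← fourier_add, sub_eq_add_neg]
      simp only [this]
      rw [integral_fourier, if_neg (sub_ne_zero.2 hm), smul_zero]
  have hgi : Integrable g AddCircle.haarAddCircle := integrable_of_continuous g.continuous
  have hae : f =ᵐ[AddCircle.haarAddCircle] g := by
    have := ae_eq_zero_of_fourierCoeff_eq_zero (hf.sub hgi) fun n => by
      have : fourierCoeff (f - ⇑g) n = fourierCoeff f n - fourierCoeff g n := by
        simp only [fourierCoeff, Pi.sub_apply, smul_sub]
        exact integral_sub (hf.fourier_smul _) (hgi.fourier_smul _)
      rw [this, hcoeff, sub_self]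
    filter_upwards [this] with x hx
    exact sub_eq_zero.1 hx
  exact (memLp_congr_ae hae).2 (memLp_top_of_bound g.continuous.aestronglyMeasurable ‖g‖
    (Filter.Eventually.of_forall g.norm_coe_le_norm))

end Uniqueness

section Nikolskii

/-- Interpolation between `L_a` and a uniform bound. -/
lemma torusNorm_le_interp {a q : ℝ≥0∞} (ha0 : a ≠ 0) (haq : a ≤ q) (haT : a ≠ ∞) {P : Torus → ℂ}
    {M : ℝ} (hM : ∀ x, ‖P x‖ ≤ M) :
    torusNorm q P ≤ ENNReal.ofReal M ^ (1 - a.toReal / q.toReal) *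
      torusNorm a P ^ (a.toReal / q.toReal) := by
  by_cases hq : q = ∞
  · subst hq
    simpa using torusNorm_le_of_bound ∞ hM
  have hq0 : q ≠ 0 := (ha0.bot_lt.trans_le haq).ne'
  have hqr : 0 < q.toReal := ENNReal.toReal_pos hq0 hq
  have har : 0 < a.toReal := ENNReal.toReal_pos ha0 haT
  have haqr : a.toReal ≤ q.toReal := ENNReal.toReal_mono hq haq
  rw [torusNorm, torusNorm, eLpNorm_eq_lintegral_rpow_enorm_toReal hq0 hq,
    eLpNorm_eq_lintegral_rpow_enorm_toReal ha0 haT, ← ENNReal.rpow_mul]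
  have h1 : ∀ x, ‖P x‖ₑ ^ q.toReal ≤
      ENNReal.ofReal M ^ (q.toReal - a.toReal) * ‖P x‖ₑ ^ a.toReal := by
    intro x
    have : ‖P x‖ₑ ^ q.toReal = ‖P x‖ₑ ^ (q.toReal - a.toReal) * ‖P x‖ₑ ^ a.toReal := by
      rw [← ENNReal.rpow_add_of_nonneg _ _ (by linarith) har.le, sub_add_cancel]
    rw [this]
    gcongr
    rw [← ofReal_norm]; exact ENNReal.ofReal_le_ofReal (hM x)
  calc _ ≤ (∫⁻ x, ENNReal.ofReal M ^ (q.toReal - a.toReal) * ‖P x‖ₑ ^ a.toReal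
        ∂AddCircle.haarAddCircle) ^ (1 / q.toReal) := by
        gcongr with x
        exact h1 x
    _ = _ := by
        rw [lintegral_const_mul' _ _ (ENNReal.rpow_ne_top_of_nonneg (by linarith)
          ENNReal.ofReal_ne_top), ENNReal.mul_rpow_of_nonneg _ _ (by positivity),
          ← ENNReal.rpow_mul]
        congr 2 <;> field_simp

lemma integral_conj_trigPoly_mul (Θ : Finset ℤ) (c : ℤ → ℂ) {g : Torus → ℂ}
    (hg : Integrable g AddCircle.haarAddCircle) :
    ∫ t, (starRingEnd ℂ) (trigPoly Θ c t) * g t ∂AddCircle.haarAddCircle =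
      ∑ n ∈ Θ, (starRingEnd ℂ) (c n) * fourierCoeff g n := by
  have h1 : ∀ t, (starRingEnd ℂ) (trigPoly Θ c t) * g t =
      ∑ n ∈ Θ, (starRingEnd ℂ) (c n) * (fourier (-n) t • g t) := by
    intro t
    rw [trigPoly, map_sum, Finset.sum_mul]
    refine Finset.sum_congr rfl fun n _ => ?_
    rw [map_mul, ← fourier_neg, smul_eq_mul]; ring
  simp only [h1]
  rw [integral_finsetSum _ fun n _ => (hg.fourier_smul (-n)).const_mul _]
  simp only [integral_const_mul, fourierCoeff]

lemma torusNorm_two_trigPoly (Θ : Finset ℤ) (c : ℤ → ℂ) :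
    torusNorm 2 (trigPoly Θ c) = ENNReal.ofReal (√(∑ n ∈ Θ, ‖c n‖ ^ 2)) := by
  have hc := continuous_trigPoly Θ c
  obtain ⟨C, hC⟩ : ∃ C, ∀ x, ‖trigPoly Θ c x‖ ≤ C := ⟨_, norm_trigPoly_le Θ c⟩
  have hm : MemLp (trigPoly Θ c) 2 AddCircle.haarAddCircle :=
    (memLp_top_of_bound hc.aestronglyMeasurable C (Filter.Eventually.of_forall hC)).mono_exponent
      le_top
  rw [torusNorm, hm.eLpNorm_eq_integral_rpow_norm (by norm_num) (by norm_num)]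
  have h1 := integral_conj_trigPoly_mul Θ c (integrable_of_continuous hc)
  have h2 : ∀ t, (starRingEnd ℂ) (trigPoly Θ c t) * trigPoly Θ c t =
      ((‖trigPoly Θ c t‖ ^ 2 : ℝ) : ℂ) := fun t => by
    rw [mul_comm, Complex.mul_conj, Complex.normSq_eq_norm_sq]
  have h3 : ∑ n ∈ Θ, (starRingEnd ℂ) (c n) * fourierCoeff (trigPoly Θ c) n =
      ((∑ n ∈ Θ, ‖c n‖ ^ 2 : ℝ) : ℂ) := by
    rw [Complex.ofReal_sum]
    refine Finset.sum_congr rfl fun n hn => ?_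
    rw [fourierCoeff_trigPoly, if_pos hn, mul_comm, Complex.mul_conj, Complex.normSq_eq_norm_sq]
  simp only [h2] at h1
  rw [h3, integral_complex_ofReal] at h1
  have h4 : ∫ t, ‖trigPoly Θ c t‖ ^ 2 ∂AddCircle.haarAddCircle = ∑ n ∈ Θ, ‖c n‖ ^ 2 := by
    exact_mod_cast h1
  simp only [ENNReal.toReal_ofNat, Real.rpow_two]
  rw [h4, Real.sqrt_eq_rpow]
  norm_num

lemma sum_norm_le_sqrt (Θ : Finset ℤ) (c : ℤ → ℂ) {D : ℝ} (hD : Θ.card ≤ D) :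
    ∑ n ∈ Θ, ‖c n‖ ≤ √D * √(∑ n ∈ Θ, ‖c n‖ ^ 2) := by
  have hD0 : 0 ≤ D := (Nat.cast_nonneg _).trans hD
  rw [← Real.sqrt_mul hD0]
  refine Real.le_sqrt_of_sq_le ?_
  refine (sq_sum_le_card_mul_sum_sq).trans ?_
  exact mul_le_mul_of_nonneg_right hD (Finset.sum_nonneg fun _ _ => by positivity)

/-- Nikol'skii's inequality for a polynomial with at most `D` frequencies, in the exponent
conjugate to `p`. -/
lemma torusNorm_conj_trigPoly_le {p q : ℝ≥0∞} (hpq : p.HolderConjugate q) (Θ : Finset ℤ)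
    (c : ℤ → ℂ) {D : ℝ} (hD1 : 1 ≤ D) (hD : Θ.card ≤ D) :
    torusNorm q (trigPoly Θ c) ≤ ENNReal.ofReal (D ^ max ((1 / p).toReal - 1 / 2) 0 *
      √(∑ n ∈ Θ, ‖c n‖ ^ 2)) := by
  set S := √(∑ n ∈ Θ, ‖c n‖ ^ 2) with hS
  have hS0 : 0 ≤ S := Real.sqrt_nonneg _
  have hsum : (1 / p).toReal + (1 / q).toReal = 1 := by
    have h := ENNReal.HolderConjugate.inv_add_inv_eq_one p q
    rw [one_div, one_div, ← ENNReal.toReal_add, h, ENNReal.toReal_one]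
    · intro h1; rw [h1, top_add] at h; exact ENNReal.top_ne_one h
    · intro h1; rw [h1, add_top] at h; exact ENNReal.top_ne_one h
  rcases le_total q 2 with hq | hq
  · have h1 : torusNorm q (trigPoly Θ c) ≤ ENNReal.ofReal S := by
      rw [hS, ← torusNorm_two_trigPoly]
      exact eLpNorm_le_eLpNorm_of_exponent_le hq (continuous_trigPoly _ _).aestronglyMeasurable
    refine h1.trans (ENNReal.ofReal_le_ofReal ?_)
    exact le_mul_of_one_le_left hS0 (Real.one_le_rpow hD1 (le_max_right _ _))
  · have hM : ∀ x, ‖trigPoly Θ c x‖ ≤ √D * S := fun x =>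
      (norm_trigPoly_le Θ c x).trans (sum_norm_le_sqrt Θ c hD)
    have h1 := torusNorm_le_interp (a := 2) (by norm_num) hq (by norm_num) hM
    refine h1.trans ?_
    set τ : ℝ := (1 / q).toReal with hτ
    have hτ' : (2 : ℝ≥0∞).toReal / q.toReal = 2 * τ := by
      rw [hτ, ENNReal.toReal_div, ENNReal.toReal_ofNat, ENNReal.toReal_one]; ring
    have hτ0 : 0 ≤ τ := ENNReal.toReal_nonneg
    have hτ2 : 2 * τ ≤ 1 := by
      have : (1 / q).toReal ≤ (1 / 2 : ℝ≥0∞).toReal :=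
        ENNReal.toReal_mono (by norm_num) (ENNReal.div_le_div_left hq 1)
      rw [← hτ, show (1 / 2 : ℝ≥0∞).toReal = 1 / 2 by simp] at this
      linarith
    rw [hτ', torusNorm_two_trigPoly, ← hS, ENNReal.ofReal_rpow_of_nonneg (by positivity)
      (by linarith), ENNReal.ofReal_rpow_of_nonneg hS0 (by linarith),
      ← ENNReal.ofReal_mul (by positivity)]
    refine ENNReal.ofReal_le_ofReal (le_of_eq ?_)
    have hmax : max ((1 / p).toReal - 1 / 2) 0 = 1 / 2 * (1 - 2 * τ) := by
      rw [max_eq_left] <;> linarith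
    rw [hmax, Real.mul_rpow (Real.sqrt_nonneg _) hS0, mul_assoc,
      ← Real.rpow_add_of_nonneg hS0 (by linarith) (by linarith), sub_add_cancel, Real.rpow_one,
      Real.sqrt_eq_rpow, ← Real.rpow_mul (by linarith)]

/-- The `ℓ_2` norm of the Fourier coefficients over `D` frequencies is at most
`D^{(1/p - 1/2)_+}` times the `L_p` norm. -/
theorem sqrt_sum_fourierCoeff_le {p : ℝ≥0∞} (hp : 1 ≤ p) {g : Torus → ℂ}
    (hg : AEStronglyMeasurable g AddCircle.haarAddCircle) {G : ℝ} (hG0 : 0 ≤ G)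
    (hG : torusNorm p g ≤ ENNReal.ofReal G) (Θ : Finset ℤ) {D : ℝ} (hD1 : 1 ≤ D)
    (hD : Θ.card ≤ D) :
    √(∑ n ∈ Θ, ‖fourierCoeff g n‖ ^ 2) ≤ D ^ max ((1 / p).toReal - 1 / 2) 0 * G := by
  set S := √(∑ n ∈ Θ, ‖fourierCoeff g n‖ ^ 2) with hS
  have hS0 : 0 ≤ S := Real.sqrt_nonneg _
  have hS2 : S ^ 2 = ∑ n ∈ Θ, ‖fourierCoeff g n‖ ^ 2 :=
    Real.sq_sqrt (Finset.sum_nonneg fun _ _ => by positivity)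
  have hgi : Integrable g AddCircle.haarAddCircle :=
    MemLp.integrable hp ⟨hg, hG.trans_lt ENNReal.ofReal_lt_top⟩
  have hpq := ENNReal.HolderConjugate.conjExponent hp
  set P := trigPoly Θ (fourierCoeff g) with hP
  have hPc : Continuous P := continuous_trigPoly _ _
  have h1 : ∫ t, (starRingEnd ℂ) (P t) * g t ∂AddCircle.haarAddCircle = ((S ^ 2 : ℝ) : ℂ) := by
    rw [hP, integral_conj_trigPoly_mul _ _ hgi, hS2, Complex.ofReal_sum]
    refine Finset.sum_congr rfl fun n hn => ?_
    rw [mul_comm, Complex.mul_conj, Complex.normSq_eq_norm_sq]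
  have h2 : ENNReal.ofReal (S ^ 2) ≤ torusNorm p g * torusNorm p.conjExponent P := by
    have h3 := eLpNorm_smul_le_mul_eLpNorm (r := 1)
      (Continuous.aestronglyMeasurable (f := fun t => (starRingEnd ℂ) (P t))
        (μ := AddCircle.haarAddCircle) (by fun_prop)) hg (hpqr := hpq)
    have h4 : eLpNorm (fun t => (starRingEnd ℂ) (P t)) p.conjExponent AddCircle.haarAddCircle =
        torusNorm p.conjExponent P :=
      eLpNorm_congr_norm_ae (Filter.Eventually.of_forall fun t => by simp)
    rw [h4] at h3
    refine le_trans ?_ h3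
    rw [eLpNorm_one_eq_lintegral_enorm]
    refine le_trans (le_of_eq ?_) (enorm_integral_le_lintegral_enorm _)
    have h5 : ∫ t, (g • fun t => (starRingEnd ℂ) (P t)) t ∂AddCircle.haarAddCircle =
        ((S ^ 2 : ℝ) : ℂ) := by
      rw [← h1]
      refine integral_congr_ae (Filter.Eventually.of_forall fun t => ?_)
      simp [mul_comm]
    rw [h5, ← ofReal_norm, Complex.norm_real, Real.norm_of_nonneg (by positivity)]
  have h3 := h2.trans (mul_le_mul' hG (torusNorm_conj_trigPoly_le hpq Θ (fourierCoeff g) hD1 hD))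
  rw [← hS, ← ENNReal.ofReal_mul hG0, ENNReal.ofReal_le_ofReal_iff (by positivity)] at h3
  rcases hS0.eq_or_lt with h | h
  · rw [← h]; positivity
  · nlinarith

end Nikolskii

section Direct

lemma modulus_mono (k : ℕ) (p : ℝ≥0∞) (f : Torus → ℂ) {s t : ℝ} (h : s ≤ t) :
    modulus k p f s ≤ modulus k p f t :=
  iSup_mono fun _ => iSup_mono' fun ha => ⟨ha.trans h, le_rfl⟩

lemma modulus_le_of_besovClass {k : ℕ} {r : ℝ} (hr : 0 ≤ r) {p θ : ℝ≥0∞} (hθ : 1 ≤ θ)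
    {f : Torus → ℂ} (hf : f ∈ besovClass k r p θ) {t : ℝ} (ht : 0 < t) :
    modulus k p f t ≤ ENNReal.ofReal (2 ^ (r + 1) * t ^ r) := by
  have hsemi : besovSeminorm k r p θ f ≤ 1 := le_add_self.trans hf.2
  suffices h : ENNReal.ofReal ((2 * t) ^ (-r)) * modulus k p f t ≤ 2 by
    have h1 : ENNReal.ofReal ((2 * t) ^ r) * (ENNReal.ofReal ((2 * t) ^ (-r)) * modulus k p f t) =
        modulus k p f t := by
      rw [← mul_assoc, ← ENNReal.ofReal_mul (by positivity), ← Real.rpow_add (by positivity),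
        add_neg_cancel, Real.rpow_zero, ENNReal.ofReal_one, one_mul]
    rw [← h1]
    refine (mul_le_mul_right h _).trans (le_of_eq ?_)
    rw [show (2 : ℝ≥0∞) = ENNReal.ofReal 2 by simp, ← ENNReal.ofReal_mul (by positivity)]
    congr 1
    rw [Real.mul_rpow (by norm_num) ht.le, Real.rpow_add (by norm_num), Real.rpow_one]
    ring
  have hanti : ∀ u : ℝ, 0 < u → u ≤ 2 * t → (2 * t) ^ (-r) ≤ u ^ (-r) := fun u hu hut =>
    Real.rpow_le_rpow_of_nonpos hu hut (by linarith)
  rw [besovSeminorm] at hsemi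
  split_ifs at hsemi with hθT
  · have h1 := (le_iSup₂ (f := fun (t : ℝ) (_ : 0 < t) =>
      ENNReal.ofReal (t ^ (-r)) * modulus k p f t) t ht).trans hsemi
    refine le_trans (le_trans ?_ h1) one_le_two
    exact mul_le_mul' (ENNReal.ofReal_le_ofReal (hanti t ht (by linarith))) le_rfl
  · set X := ENNReal.ofReal ((2 * t) ^ (-r)) * modulus k p f t
    have hθ0 : θ ≠ 0 := (zero_lt_one.trans_le hθ).ne'
    have hθr : 0 < θ.toReal := ENNReal.toReal_pos hθ0 hθT
    have hθ1 : 1 ≤ θ.toReal := by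
      rw [← ENNReal.toReal_one]; exact ENNReal.toReal_mono hθT hθ
    set I := ∫⁻ t in Set.Ioi (0 : ℝ),
      (ENNReal.ofReal (t ^ (-r)) * modulus k p f t) ^ θ.toReal * ENNReal.ofReal (1 / t) with hI
    have hI1 : I ≤ 1 := by
      have := ENNReal.rpow_le_rpow hsemi hθr.le
      rwa [← ENNReal.rpow_mul, one_div_mul_cancel hθr.ne', ENNReal.rpow_one, ENNReal.one_rpow]
        at this
    have hlow : X ^ θ.toReal * ENNReal.ofReal (1 / 2) ≤ I := by
      calc X ^ θ.toReal * ENNReal.ofReal (1 / 2)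
          = ∫⁻ _u in Set.Ioc t (2 * t), X ^ θ.toReal * ENNReal.ofReal (1 / (2 * t)) := by
            rw [setLIntegral_const, Real.volume_Ioc, mul_assoc,
              ← ENNReal.ofReal_mul (by positivity)]
            congr 2
            field_simp
            ring
        _ ≤ ∫⁻ u in Set.Ioc t (2 * t),
            (ENNReal.ofReal (u ^ (-r)) * modulus k p f u) ^ θ.toReal * ENNReal.ofReal (1 / u) := by
            refine setLIntegral_mono' measurableSet_Ioc fun u hu => ?_
            have hu0 : 0 < u := ht.trans hu.1
            have h1 := hanti u hu0 hu.2
            have h2 := modulus_mono k p f hu.1.le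
            have h3 : 1 / (2 * t) ≤ 1 / u := one_div_le_one_div_of_le hu0 hu.2
            exact mul_le_mul' (ENNReal.rpow_le_rpow (mul_le_mul' (ENNReal.ofReal_le_ofReal h1) h2)
              hθr.le) (ENNReal.ofReal_le_ofReal h3)
        _ ≤ I := lintegral_mono_set fun u hu => ht.trans hu.1
    have hX : X ^ θ.toReal ≤ 2 := by
      have h1 := mul_le_mul_left (hlow.trans hI1) 2
      rw [mul_assoc, one_mul] at h1
      rw [show (2 : ℝ≥0∞) = ENNReal.ofReal 2 by simp, ← ENNReal.ofReal_mul (by positivity)] at h1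
      norm_num at h1
      exact h1
    have h2 : X ^ θ.toReal ≤ 2 ^ θ.toReal := by
      refine hX.trans ?_
      conv_lhs => rw [← ENNReal.rpow_one 2]
      exact ENNReal.rpow_le_rpow_of_exponent_le one_le_two hθ1
    exact (ENNReal.rpow_le_rpow_iff hθr).1 h2

lemma integrable_of_inLp {p : ℝ≥0∞} (hp : 1 ≤ p) {f : Torus → ℂ} (hf : InLp p f) :
    Integrable f AddCircle.haarAddCircle := MemLp.integrable hp hf

lemma integrable_translate {f : Torus → ℂ} (hf : Integrable f AddCircle.haarAddCircle)
    (y : Torus) : Integrable (fun x => f (x + y)) AddCircle.haarAddCircle :=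
  (measurePreserving_add_right AddCircle.haarAddCircle y).integrable_comp_of_integrable hf

lemma fourierCoeff_translate (f : Torus → ℂ) (h : ℝ) (n : ℤ) :
    fourierCoeff (fun x => f (x + (h : Torus))) n = fourier n (h : Torus) * fourierCoeff f n := by
  have h1 : ∀ t : Torus, fourier (-n) t • f (t + (h : Torus)) =
      (fun s => fourier n (h : Torus) * (fourier (-n) s • f s)) (t + (h : Torus)) := by
    intro t
    simp only [smul_eq_mul, fourier_apply_add]
    have : fourier n (h : Torus) * fourier (-n) (h : Torus) = 1 := by
      rw [← fourier_add, add_neg_cancel, fourier_zero_apply]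
    linear_combination -(fourier (-n) t * f (t + (h : Torus))) * this
  rw [fourierCoeff]
  simp only [h1]
  rw [integral_add_right_eq_self (fun s => fourier n (h : Torus) * (fourier (-n) s • f s)),
    integral_const_mul]
  rfl

lemma integrable_diffOp {f : Torus → ℂ} (hf : Integrable f AddCircle.haarAddCircle) (h : ℝ)
    (k : ℕ) : Integrable (diffOp k h f) AddCircle.haarAddCircle := by
  induction k with
  | zero => exact hf
  | succ k ih =>
    rw [diffOp, Function.iterate_succ_apply']
    exact (integrable_translate ih _).sub ih

lemma fourierCoeff_diffOp {f : Torus → ℂ} (hf : Integrable f AddCircle.haarAddCircle) (h : ℝ)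
    (k : ℕ) (n : ℤ) :
    fourierCoeff (diffOp k h f) n = (fourier n (h : Torus) - 1) ^ k * fourierCoeff f n := by
  induction k with
  | zero => simp [diffOp]
  | succ k ih =>
    have hi := integrable_diffOp hf h k
    rw [diffOp, Function.iterate_succ_apply', ← diffOp]
    have : fourierCoeff (fun x => diffOp k h f (x + (h : Torus)) - diffOp k h f x) n =
        fourierCoeff (fun x => diffOp k h f (x + (h : Torus))) n - fourierCoeff (diffOp k h f) n := by
      simp only [fourierCoeff, smul_sub]
      exact integral_sub ((integrable_translate hi _).fourier_smul _) (hi.fourier_smul _)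
    rw [this, fourierCoeff_translate, ih]
    ring

lemma quarter_le_norm_fourier_sub_one {n : ℤ} {h : ℝ} (h1 : 1 / 2 ≤ |n * h|) (h2 : |n * h| ≤ 1) :
    1 / 4 ≤ ‖fourier n (h : Torus) - 1‖ := by
  rw [fourier_coe_eq, mul_comm, Complex.norm_exp_I_mul_ofReal_sub_one, norm_mul, Real.norm_eq_abs,
    Real.norm_eq_abs, abs_of_pos (by norm_num : (0 : ℝ) < 2)]
  have hpi := Real.pi_gt_three
  have hpi4 := Real.pi_lt_four
  have h3 : |Real.sin (n * h / 2)| = Real.sin (|n * h| / 2) := by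
    rcases abs_cases (n * h : ℝ) with ⟨e, _⟩ | ⟨e, _⟩
    · rw [e, abs_of_nonneg]
      exact Real.sin_nonneg_of_nonneg_of_le_pi (by linarith) (by linarith)
    · rw [e, neg_div, Real.sin_neg, abs_of_nonpos]
      exact Real.sin_nonpos_of_nonpos_of_neg_pi_le (by linarith) (by linarith)
  rw [h3]
  have h4 := Real.mul_le_sin (x := |n * h| / 2) (by linarith) (by linarith)
  have h5 : 1 / 2 ≤ 2 / Real.pi := by rw [div_le_div_iff₀] <;> linarith
  nlinarith

/-- The constant in the estimate of the dyadic blocks of functions of the Besov class. -/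
def blockConst (k : ℕ) (r : ℝ) : ℝ := 4 ^ k * 6 * 2 ^ (r + 1)

lemma one_le_blockConst (k : ℕ) {r : ℝ} (hr : 0 ≤ r) : 1 ≤ blockConst k r := by
  have h1 : (1 : ℝ) ≤ 4 ^ k := one_le_pow₀ (by norm_num)
  have h2 : (1 : ℝ) ≤ 2 ^ (r + 1) := Real.one_le_rpow (by norm_num) (by linarith)
  unfold blockConst
  nlinarith

/-- Functions of the Besov class have dyadic blocks of Fourier coefficients with geometrically
decreasing sums. -/
theorem sum_dyadicBlock_le {k : ℕ} {r : ℝ} (hr : 0 ≤ r) {p θ : ℝ≥0∞} (hp : 1 ≤ p) (hθ : 1 ≤ θ)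
    {f : Torus → ℂ} (hf : f ∈ besovClass k r p θ) (j : ℕ) :
    ∑ n ∈ dyadicBlock j, ‖fourierCoeff f n‖ ≤ blockConst k r *
      2 ^ (-(r - max ((1 / p).toReal - 1 / 2) 0 - 1 / 2) * j) := by
  set γ := max ((1 / p).toReal - 1 / 2) 0 with hγ
  have hγ0 : 0 ≤ γ := le_max_right _ _
  have hγ1 : γ ≤ 1 / 2 := by
    refine max_le ?_ (by norm_num)
    have : (1 / p).toReal ≤ (1 : ℝ≥0∞).toReal := by
      refine ENNReal.toReal_mono ENNReal.one_ne_top ?_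
      rw [one_div]; exact ENNReal.inv_le_one.2 hp
    rw [ENNReal.toReal_one] at this
    linarith
  have hfi := integrable_of_inLp hp hf.1
  rcases Nat.eq_zero_or_pos j with rfl | hj
  · have h0 : dyadicBlock 0 = {0} := by
      ext n; rw [mem_dyadicBlock, Nat.size_eq_zero]; simp
    rw [h0, Finset.sum_singleton]
    simp only [Nat.cast_zero, mul_zero, Real.rpow_zero, mul_one]
    refine le_trans ?_ (one_le_blockConst k hr)
    have h1 : torusNorm 1 f ≤ 1 :=
      (eLpNorm_le_eLpNorm_of_exponent_le hp hf.1.1).trans (le_self_add.trans hf.2)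
    rw [torusNorm, eLpNorm_one_eq_lintegral_enorm] at h1
    have h2 := (enorm_integral_le_lintegral_enorm (fun t => fourier (-0) t • f t)
      (μ := AddCircle.haarAddCircle (T := 2 * Real.pi)))
    simp only [neg_zero, fourier_zero_apply, one_smul] at h2
    have h3 := h2.trans h1
    rw [← ofReal_norm, ENNReal.ofReal_le_one] at h3
    simpa only [fourierCoeff, neg_zero, fourier_zero_apply, one_smul] using h3
  set h : ℝ := ((2 : ℝ) ^ j)⁻¹ with hh
  have h2j : (0 : ℝ) < 2 ^ j := by positivity
  have hh0 : 0 < h := by positivity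
  set g := diffOp k h f with hg
  set G : ℝ := 2 ^ (r + 1) * h ^ r with hG
  have hG0 : 0 ≤ G := by positivity
  have hgG : torusNorm p g ≤ ENNReal.ofReal G :=
    le_trans (le_iSup₂ (f := fun (a : ℝ) (_ : |a| ≤ h) => torusNorm p (diffOp k a f)) h
      (abs_of_pos hh0).le) (modulus_le_of_besovClass hr hθ hf hh0)
  have hcard : ((dyadicBlock j).card : ℝ) ≤ 3 * 2 ^ j := by exact_mod_cast card_dyadicBlock_le j
  have hD1 : (1 : ℝ) ≤ 3 * 2 ^ j := by
    have : (1 : ℝ) ≤ 2 ^ j := one_le_pow₀ (by norm_num)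
    linarith
  have h1 := sqrt_sum_fourierCoeff_le hp (integrable_diffOp hfi h k).aestronglyMeasurable hG0 hgG
    (dyadicBlock j) hD1 hcard
  have h2 := sum_norm_le_sqrt (dyadicBlock j) (fourierCoeff g) hcard
  have h3 : ∑ n ∈ dyadicBlock j, ‖fourierCoeff f n‖ ≤
      4 ^ k * ∑ n ∈ dyadicBlock j, ‖fourierCoeff g n‖ := by
    rw [Finset.mul_sum]
    refine Finset.sum_le_sum fun n hn => ?_
    rw [mem_dyadicBlock] at hn
    have hn1 : n.natAbs < 2 ^ j := by rw [← hn]; exact Nat.lt_size_self _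
    have hn2 : 2 ^ (j - 1) ≤ n.natAbs := Nat.lt_size.1 (by omega)
    have hn3 : 2 ^ j ≤ 2 * n.natAbs := by
      have : 2 ^ j = 2 * 2 ^ (j - 1) := by
        conv_lhs => rw [← Nat.sub_add_cancel hj, pow_succ]
        ring
      omega
    have habs : |(n : ℝ)| = n.natAbs := by rw [Nat.cast_natAbs]; simp
    have hn1' : |(n : ℝ)| ≤ 2 ^ j := by rw [habs]; exact_mod_cast hn1.le
    have hn3' : (2 : ℝ) ^ j ≤ 2 * |(n : ℝ)| := by rw [habs]; exact_mod_cast hn3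
    have hq : 1 / 4 ≤ ‖fourier n (h : Torus) - 1‖ := by
      apply quarter_le_norm_fourier_sub_one
      · rw [abs_mul, abs_of_pos hh0, hh, ← div_eq_mul_inv, le_div_iff₀ h2j]; linarith
      · rw [abs_mul, abs_of_pos hh0, hh, ← div_eq_mul_inv, div_le_one h2j]; exact hn1'
    rw [hg, fourierCoeff_diffOp hfi, norm_mul, norm_pow, ← mul_assoc, ← mul_pow]
    refine le_mul_of_one_le_left (norm_nonneg _) (one_le_pow₀ ?_)
    linarith
  have hpow : ∀ x : ℝ, (2 : ℝ) ^ (x * j) = ((2 : ℝ) ^ j) ^ x := fun x => by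
    rw [mul_comm, Real.rpow_mul (by norm_num), Real.rpow_natCast]
  have h4 : √(3 * (2 : ℝ) ^ j) ≤ 2 * (2 ^ j) ^ (1 / 2 : ℝ) := by
    rw [← Real.sqrt_eq_rpow, Real.sqrt_mul (by norm_num)]
    gcongr
    rw [Real.sqrt_le_left (by norm_num)]; norm_num
  have h5 : (3 * (2 : ℝ) ^ j) ^ γ ≤ 3 * (2 ^ j) ^ γ := by
    rw [Real.mul_rpow (by norm_num) h2j.le]
    gcongr
    calc (3 : ℝ) ^ γ ≤ 3 ^ (1 : ℝ) :=
          Real.rpow_le_rpow_of_exponent_le (by norm_num) (by linarith)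
      _ = 3 := Real.rpow_one 3
  have h6 : h ^ r = ((2 : ℝ) ^ j) ^ (-r) := by
    rw [hh, Real.inv_rpow h2j.le, Real.rpow_neg h2j.le]
  calc _ ≤ 4 ^ k * (√(3 * 2 ^ j) * ((3 * 2 ^ j) ^ γ * G)) :=
        h3.trans (mul_le_mul_of_nonneg_left
          (h2.trans (mul_le_mul_of_nonneg_left h1 (Real.sqrt_nonneg _))) (by positivity))
    _ ≤ 4 ^ k * ((2 * (2 ^ j) ^ (1 / 2 : ℝ)) * ((3 * (2 ^ j) ^ γ) * G)) := by gcongr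
    _ = blockConst k r * (((2 : ℝ) ^ j) ^ (1 / 2 : ℝ) * (2 ^ j) ^ γ * ((2 : ℝ) ^ j) ^ (-r)) := by
        rw [hG, h6, blockConst]; ring
    _ = _ := by
        rw [← Real.rpow_add h2j, ← Real.rpow_add h2j, hpow]
        congr 2
        ring

end Direct

section Upper

lemma summable_norm_fourierCoeff_of_dyadicBlock {f : Torus → ℂ} {C q : ℝ} (hq0 : 0 < q)
    (hq1 : q < 1) (hC : 0 < C) (H : ∀ j, ∑ n ∈ dyadicBlock j, ‖fourierCoeff f n‖ ≤ C * q ^ j) :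
    Summable fun n => ‖fourierCoeff f n‖ := by
  have hs : Summable fun j : ℕ => C * q ^ j := (summable_geometric_of_lt_one hq0.le hq1).mul_left C
  refine summable_of_sum_le (c := ∑' j, C * q ^ j) (fun _ => norm_nonneg _) fun F => ?_
  rw [← Finset.sum_fiberwise_of_maps_to
    (fun n hn => Finset.mem_image_of_mem (fun n : ℤ => n.natAbs.size) hn)]
  refine le_trans (Finset.sum_le_sum fun j _ => le_trans ?_ (H j))
    (hs.sum_le_tsum _ fun j _ => by positivity)
  refine Finset.sum_le_sum_of_subset_of_nonneg (fun n hn => ?_) fun _ _ _ => norm_nonneg _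
  exact mem_dyadicBlock.2 (Finset.mem_filter.1 hn).2

lemma bqOneNorm_le_of_dyadicBlock {f : Torus → ℂ} (hf : Integrable f AddCircle.haarAddCircle)
    {C q : ℝ} (hq0 : 0 < q) (hq1 : q < 1)
    (H : ∀ j, ∑ n ∈ dyadicBlock j, ‖fourierCoeff f n‖ ≤ C * q ^ j) :
    bqOneNorm ∞ f ≤ ENNReal.ofReal (12 * ∑' j : ℕ, C * q ^ j) :=
  bqOneNorm_le_tsum hf (fun j x => (norm_trigPoly_le _ _ x).trans (H j))
    ((summable_geometric_of_lt_one hq0.le hq1).mul_left C)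

lemma integrable_trigPoly (Θ : Finset ℤ) (c : ℤ → ℂ) :
    Integrable (trigPoly Θ c) AddCircle.haarAddCircle :=
  integrable_of_continuous (continuous_trigPoly Θ c)

lemma fourierCoeff_sub_trigPoly {f : Torus → ℂ} (hf : Integrable f AddCircle.haarAddCircle)
    (Θ : Finset ℤ) (c : ℤ → ℂ) (n : ℤ) :
    fourierCoeff (fun x => f x - trigPoly Θ c x) n =
      fourierCoeff f n - if n ∈ Θ then c n else 0 := by
  rw [← fourierCoeff_trigPoly]
  simp only [fourierCoeff, smul_sub]
  exact integral_sub (hf.fourier_smul _) ((integrable_trigPoly Θ c).fourier_smul _)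

lemma card_biUnion_dyadicBlock_le (n : ℕ) :
    ((Finset.range (n + 1)).biUnion dyadicBlock).card ≤ 6 * 2 ^ n := by
  refine Finset.card_biUnion_le.trans ((Finset.sum_le_sum fun j _ => card_dyadicBlock_le j).trans ?_)
  rw [← Finset.mul_sum]
  have := Nat.geomSum_eq (le_refl 2) (n + 1)
  rw [this, pow_succ]
  omega

/-- The size of the error of sparse approximation in the `i`-th block beyond the full ones. -/
def tailError (C q : ℝ) (i : ℕ) : ℝ := C * √q ^ i * (4 * (i * Real.log (2 / q)) + sparseConst)

lemma summable_tailError (C : ℝ) {q : ℝ} (hq1 : q < 1) :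
    Summable (tailError C q) := by
  have h1 : ‖√q‖ < 1 := by
    rw [Real.norm_of_nonneg (Real.sqrt_nonneg _), Real.sqrt_lt' one_pos]; simpa using hq1
  have h2 := (summable_pow_mul_geometric_of_norm_lt_one 1 h1).mul_left (C * 4 * Real.log (2 / q))
  have h3 := (summable_pow_mul_geometric_of_norm_lt_one 0 h1).mul_left (C * sparseConst)
  refine (h2.add h3).congr fun i => ?_
  simp only [tailError, pow_one, pow_zero]
  ring

/-- Functions with geometrically decreasing dyadic blocks are approximated with
`O(2^n)` terms up to an error `O((q / √2)^n)`. -/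
theorem exists_sparse_approx {f : Torus → ℂ} (hf : Integrable f AddCircle.haarAddCircle)
    {C q : ℝ} (hC : 0 < C) (hq0 : 0 < q) (hq1 : q < 1)
    (H : ∀ j, ∑ n ∈ dyadicBlock j, ‖fourierCoeff f n‖ ≤ C * q ^ j) (n : ℕ) :
    ∃ (Θ : Finset ℤ) (c : ℤ → ℂ), (Θ.card : ℝ) ≤ (6 + 2 / (1 - q)) * 2 ^ n ∧
      bqOneNorm ∞ (fun x => f x - trigPoly Θ c x) ≤
        ENNReal.ofReal (12 * ((q / √2) ^ n * ∑' i, tailError C q i)) := by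
  classical
  have hl : 0 ≤ Real.log (2 / q) := Real.log_nonneg (by rw [le_div_iff₀ hq0]; linarith)
  have hex : ∀ i : ℕ, ∃ d : ℤ → ℂ, (∀ m ∉ dyadicBlock (n + i), d m = 0) ∧
      (((dyadicBlock (n + i)).filter fun m => d m ≠ 0).card : ℝ) ≤ 2 * (2 ^ n * q ^ i) ∧
      ∀ x, ‖trigPoly (dyadicBlock (n + i)) (fun m => fourierCoeff f m - d m) x‖ ≤
        C * q ^ (n + i) / √(2 ^ n * q ^ i) * (4 * (i * Real.log (2 / q)) + sparseConst) := by
    intro i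
    refine exists_sparse_trigPoly (N := 2 ^ (n + i)) (by positivity) _
      (fun m hm => (natAbs_lt_of_mem_dyadicBlock hm).le) _ (by positivity) (H (n + i))
      (by positivity) (by positivity) (le_of_eq ?_)
    rw [Real.exp_nat_mul, Real.exp_log (by positivity)]
    push_cast
    rw [pow_add, div_pow]
    field_simp
  choose D hD0 hDcard hDerr using hex
  obtain ⟨I, hI⟩ : ∃ I : ℕ, ∀ i ≥ I, 2 * (2 ^ n * q ^ i) < 1 := by
    have h1 := ((tendsto_pow_atTop_nhds_zero_of_lt_one hq0.le hq1).const_mul (2 * 2 ^ n))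
    rw [mul_zero] at h1
    obtain ⟨I, hI⟩ := Filter.eventually_atTop.1 (h1.eventually (gt_mem_nhds one_pos))
    exact ⟨I, fun i hi => by have := hI i hi; linarith⟩
  let d : ℤ → ℂ := fun m =>
    if m.natAbs.size ≤ n then fourierCoeff f m else D (m.natAbs.size - n) m
  let Θ : Finset ℤ := (Finset.range (n + 1)).biUnion dyadicBlock ∪
    (Finset.range I).biUnion fun i => (dyadicBlock (n + i)).filter fun m => D i m ≠ 0
  have hdΘ : ∀ m ∉ Θ, d m = 0 := by
    intro m hm
    simp only [Θ, Finset.mem_union, Finset.mem_biUnion, Finset.mem_range, mem_dyadicBlock,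
      Finset.mem_filter, not_or, not_exists, not_and] at hm
    have h1 : ¬ m.natAbs.size ≤ n := fun h => hm.1 _ (by omega) rfl
    simp only [d, if_neg h1]
    set i := m.natAbs.size - n with hi
    have h2 : m.natAbs.size = n + i := by omega
    by_contra h3
    by_cases h4 : i < I
    · exact hm.2 i h4 h2 h3
    · have h5 := (hDcard i).trans_lt (hI i (not_lt.1 h4))
      have h6 : ((dyadicBlock (n + i)).filter fun m => D i m ≠ 0).card = 0 := by
        have : ((dyadicBlock (n + i)).filter fun m => D i m ≠ 0).card < 1 := by exact_mod_cast h5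
        omega
      rw [Finset.card_eq_zero] at h6
      have h7 : m ∈ (dyadicBlock (n + i)).filter fun m => D i m ≠ 0 :=
        Finset.mem_filter.2 ⟨mem_dyadicBlock.2 h2, h3⟩
      rw [h6] at h7
      exact absurd h7 (Finset.notMem_empty m)
  refine ⟨Θ, d, ?_, ?_⟩
  · have h1 : (Θ.card : ℝ) ≤ 6 * 2 ^ n + ∑ i ∈ Finset.range I, 2 * (2 ^ n * q ^ i) := by
      have h2 : Θ.card ≤ 6 * 2 ^ n + ∑ i ∈ Finset.range I,
          ((dyadicBlock (n + i)).filter fun m => D i m ≠ 0).card :=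
        (Finset.card_union_le _ _).trans
          (Nat.add_le_add (card_biUnion_dyadicBlock_le n) Finset.card_biUnion_le)
      refine (Nat.cast_le.2 h2).trans ?_
      push_cast
      gcongr with i
      exact hDcard i
    refine h1.trans ?_
    simp only [← Finset.mul_sum]
    have h3 : ∑ i ∈ Finset.range I, q ^ i ≤ 1 / (1 - q) := by
      rw [one_div, ← tsum_geometric_of_lt_one hq0.le hq1]
      exact (summable_geometric_of_lt_one hq0.le hq1).sum_le_tsum _ fun i _ => by positivity
    have h4 : (6 + 2 / (1 - q)) * 2 ^ n = 6 * 2 ^ n + 2 * (2 ^ n * (1 / (1 - q))) := by ring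
    rw [h4]
    gcongr
  · have hcoeff : ∀ m, fourierCoeff (fun x => f x - trigPoly Θ d x) m = fourierCoeff f m - d m := by
      intro m
      rw [fourierCoeff_sub_trigPoly hf]
      split_ifs with h
      · rfl
      · rw [hdΘ m h]
    set ε : ℕ → ℝ := fun j => if j < n then 0 else (q / √2) ^ n * tailError C q (j - n) with hε
    have htail : ∀ i, 0 ≤ tailError C q i := fun i => by
      have := sparseConst_pos
      unfold tailError; positivity
    have hεn : ∀ i, ε (i + n) = (q / √2) ^ n * tailError C q i := fun i => by
      simp [hε]
    have hsum : Summable ε := by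
      rw [← summable_nat_add_iff n]
      simp only [hεn]
      exact (summable_tailError C hq1).mul_left _
    have htsum : ∑' j, ε j = (q / √2) ^ n * ∑' i, tailError C q i := by
      rw [← hsum.sum_add_tsum_nat_add n, Finset.sum_eq_zero, zero_add]
      · simp only [hεn, tsum_mul_left]
      · intro j hj
        simp [hε, Finset.mem_range.1 hj]
    rw [← htsum]
    have hi : Integrable (fun x => f x - trigPoly Θ d x) AddCircle.haarAddCircle :=
      hf.sub (integrable_trigPoly Θ d)
    refine bqOneNorm_le_tsum hi (fun j x => ?_) hsum
    have hfun : trigPoly (dyadicBlock j) (fourierCoeff fun x => f x - trigPoly Θ d x) =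
        trigPoly (dyadicBlock j) fun m => fourierCoeff f m - d m := by
      congr 1; ext m; exact hcoeff m
    rw [hfun]
    rcases le_or_gt j n with hj | hj
    · have h0 : trigPoly (dyadicBlock j) (fun m => fourierCoeff f m - d m) x = 0 := by
        refine Finset.sum_eq_zero fun m hm => ?_
        rw [mem_dyadicBlock] at hm
        simp only [d, if_pos (hm.trans_le hj), sub_self, zero_mul]
      rw [h0, norm_zero]
      simp only [hε]
      split_ifs
      · exact le_rfl
      · exact mul_nonneg (by positivity) (htail _)
    · obtain ⟨i, rfl⟩ := Nat.exists_eq_add_of_le hj.le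
      have h1 : trigPoly (dyadicBlock (n + i)) (fun m => fourierCoeff f m - d m) x =
          trigPoly (dyadicBlock (n + i)) (fun m => fourierCoeff f m - D i m) x := by
        refine Finset.sum_congr rfl fun m hm => ?_
        rw [mem_dyadicBlock] at hm
        have h2 : ¬ m.natAbs.size ≤ n := by omega
        have h3 : m.natAbs.size - n = i := by omega
        simp only [d, if_neg h2, h3]
      rw [h1, add_comm n i, hεn, add_comm i n]
      refine (hDerr i x).trans (le_of_eq ?_)
      have h2 : √(2 ^ n * q ^ i) = √2 ^ n * √q ^ i := by
        have hpow : ∀ (a : ℝ) (i : ℕ), 0 ≤ a → √(a ^ i) = √a ^ i := fun a i ha => by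
          rw [← Real.sqrt_sq (pow_nonneg (Real.sqrt_nonneg a) i), ← pow_mul, mul_comm, pow_mul,
            Real.sq_sqrt ha]
        rw [Real.sqrt_mul (by positivity), hpow 2 n (by norm_num), hpow q i hq0.le]
      have h3 : q ^ i = √q ^ i * √q ^ i := by rw [← mul_pow, Real.mul_self_sqrt hq0.le]
      have h4 : 0 < √q := Real.sqrt_pos.2 hq0
      have h5 : 0 < √(2 : ℝ) := Real.sqrt_pos.2 two_pos
      rw [h2, tailError, pow_add, h3, div_pow]
      field_simp

lemma bestMTerm_le {N : (Torus → ℂ) → ℝ≥0∞} {m : ℕ} {f : Torus → ℂ} {Θ : Finset ℤ}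
    (hΘ : Θ.card ≤ m) (c : ℤ → ℂ) :
    bestMTerm N m f ≤ N fun x => f x - trigPoly Θ c x := by
  classical
  obtain ⟨Θ', hsub, hcard⟩ := Infinite.exists_superset_card_eq Θ m hΘ
  have h1 : trigPoly Θ' (fun n => if n ∈ Θ then c n else 0) = trigPoly Θ c := by
    rw [trigPoly_subset hsub _ fun n _ h => if_neg h]
    ext x
    exact Finset.sum_congr rfl fun n hn => by simp only [if_pos hn]
  refine (iInf₂_le Θ' hcard).trans ((iInf_le _ (fun n => if n ∈ Θ then c n else 0)).trans ?_)
  rw [h1]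

/-- The rate of best `m`-term approximation of functions with geometrically decreasing dyadic
blocks. -/
theorem exists_bestMTerm_le {C κ : ℝ} (hC : 0 < C) (hκ : 0 < κ) :
    ∃ C₂ : ℝ, 0 < C₂ ∧ ∀ f : Torus → ℂ, Integrable f AddCircle.haarAddCircle →
      (∀ j : ℕ, ∑ n ∈ dyadicBlock j, ‖fourierCoeff f n‖ ≤ C * 2 ^ (-κ * j)) →
      ∀ m : ℕ, 1 ≤ m → bestMTerm (bqOneNorm ∞) m f ≤
        ENNReal.ofReal (C₂ * (m : ℝ) ^ (-(κ + 1 / 2))) := by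
  set q : ℝ := 2 ^ (-κ) with hq
  have hq0 : 0 < q := by positivity
  have hq1 : q < 1 := Real.rpow_lt_one_of_one_lt_of_neg (by norm_num) (by linarith)
  have hqj : ∀ j : ℕ, (2 : ℝ) ^ (-κ * j) = q ^ j := fun j => by
    rw [Real.rpow_mul (by norm_num), Real.rpow_natCast]
  set α := κ + 1 / 2 with hα
  have hα0 : 0 < α := by positivity
  have hρ : q / √2 = 2 ^ (-α) := by
    rw [hq, hα, Real.sqrt_eq_rpow, ← Real.rpow_sub (by norm_num)]
    congr 1; ring
  set K : ℕ := ⌈6 + 2 / (1 - q)⌉₊ with hK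
  have h1q : 0 < 1 - q := by linarith
  have hK6 : 6 + 2 / (1 - q) ≤ K := Nat.le_ceil _
  have hK0 : (0 : ℝ) < K := lt_of_lt_of_le (by positivity) hK6
  have hK0' : 0 < K := by exact_mod_cast hK0
  set S₀ := ∑' j : ℕ, C * q ^ j
  set S₁ := ∑' i, tailError C q i
  have hS₀ : 0 ≤ S₀ := tsum_nonneg fun j => by positivity
  have hS₁ : 0 ≤ S₁ := tsum_nonneg fun i => by
    have := sparseConst_pos
    have hl : 0 ≤ Real.log (2 / q) := Real.log_nonneg (by rw [le_div_iff₀ hq0]; linarith)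
    unfold tailError; positivity
  refine ⟨(12 * S₀ + 12 * S₁ + 1) * (2 * K) ^ α, by positivity, fun f hf H m hm => ?_⟩
  simp only [hqj] at H
  have hm0 : (0 : ℝ) < m := by exact_mod_cast hm
  have hm1 : ((2 * K : ℝ)) ^ α * (m : ℝ) ^ (-α) = (2 * K / m) ^ α := by
    rw [Real.div_rpow (by positivity) hm0.le, Real.rpow_neg hm0.le]; rfl
  rw [mul_assoc, hm1]
  rcases lt_or_ge m K with hmK | hmK
  · have h1 := bestMTerm_le (N := bqOneNorm ∞) (f := f) (Θ := ∅) (m := m) (by simp) 0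
    have h2 : (fun x => f x - trigPoly ∅ 0 x) = f := by ext x; simp [trigPoly]
    rw [h2] at h1
    refine h1.trans ((bqOneNorm_le_of_dyadicBlock hf hq0 hq1 H).trans
      (ENNReal.ofReal_le_ofReal ?_))
    have h3 : 1 ≤ (2 * K / m : ℝ) ^ α := by
      refine Real.one_le_rpow ?_ hα0.le
      rw [le_div_iff₀ hm0]
      have : (m : ℝ) ≤ K := by exact_mod_cast hmK.le
      linarith
    change 12 * S₀ ≤ _
    nlinarith
  · set n := Nat.log 2 (m / K) with hn
    have hdiv : m / K ≠ 0 := (Nat.div_pos hmK hK0').ne'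
    have hn1 : 2 ^ n ≤ m / K := Nat.pow_log_le_self 2 hdiv
    have hn2 : m / K < 2 ^ (n + 1) := Nat.lt_pow_succ_log_self (by norm_num) _
    have hn1' : 2 ^ n * K ≤ m := (Nat.le_div_iff_mul_le hK0').1 hn1
    have hn2' : m < 2 ^ (n + 1) * K := (Nat.div_lt_iff_lt_mul hK0').1 hn2
    obtain ⟨Θ, c, hcard, herr⟩ := exists_sparse_approx hf hC hq0 hq1 H n
    have hΘm : Θ.card ≤ m := by
      refine le_trans ?_ hn1'
      have : (Θ.card : ℝ) ≤ 2 ^ n * K := hcard.trans (by rw [mul_comm]; gcongr)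
      exact_mod_cast this
    refine (bestMTerm_le hΘm c).trans (herr.trans (ENNReal.ofReal_le_ofReal ?_))
    have h3 : (q / √2) ^ n ≤ (2 * K / m : ℝ) ^ α := by
      have h4 : (q / √2) ^ n = (1 / 2 ^ n : ℝ) ^ α := by
        rw [hρ, ← Real.rpow_natCast, ← Real.rpow_mul (by norm_num), mul_comm, Real.rpow_mul
          (by norm_num), Real.rpow_natCast, Real.div_rpow (by norm_num) (by positivity),
          Real.one_rpow, Real.rpow_neg (by positivity), one_div]
      rw [h4]
      refine Real.rpow_le_rpow (by positivity) ?_ hα0.le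
      rw [div_le_div_iff₀ (by positivity) hm0]
      have : (m : ℝ) ≤ 2 ^ (n + 1) * K := by exact_mod_cast hn2'.le
      rw [pow_succ] at this
      linarith
    have h5 : 0 ≤ (2 * K / m : ℝ) ^ α := by positivity
    change 12 * ((q / √2) ^ n * S₁) ≤ _
    nlinarith [mul_le_mul_of_nonneg_right h3 hS₁, mul_nonneg hS₀ h5]

end Upper

section BesovPoly

lemma translate_sub_trigPoly (Θ : Finset ℤ) (c : ℤ → ℂ) (h : ℝ) :
    (fun x => trigPoly Θ c (x + (h : Torus)) - trigPoly Θ c x) =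
      trigPoly Θ fun n => (fourier n (h : Torus) - 1) * c n := by
  ext x
  simp only [trigPoly, ← Finset.sum_sub_distrib]
  refine Finset.sum_congr rfl fun n _ => ?_
  rw [fourier_apply_add]; ring

lemma torusNorm_translate_sub_le_min {p : ℝ≥0∞} (hp : 1 ≤ p) {N : ℕ} (hN : 0 < N)
    (Θ : Finset ℤ) (hΘ : ∀ n ∈ Θ, n.natAbs ≤ N) (c : ℤ → ℂ) (h : ℝ) :
    torusNorm p (fun x => trigPoly Θ c (x + (h : Torus)) - trigPoly Θ c x) ≤
      ENNReal.ofReal (2 * min 1 (N * |h|)) * torusNorm p (trigPoly Θ c) := by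
  have hc := continuous_trigPoly Θ c
  rcases le_total (1 : ℝ) (N * |h|) with h1 | h1
  · rw [min_eq_left h1, mul_one]
    refine (eLpNorm_sub_le (Continuous.aestronglyMeasurable (by fun_prop))
      hc.aestronglyMeasurable hp).trans (le_of_eq ?_)
    have := torusNorm_comp_add p hc.aestronglyMeasurable (h : Torus)
    rw [torusNorm, torusNorm] at this
    rw [this, torusNorm, ENNReal.ofReal_ofNat]
    exact (two_mul _).symm
  · rw [min_eq_right h1, ← mul_assoc]
    exact torusNorm_translate_sub_le_degree hp hN Θ hΘ c h

lemma torusNorm_diffOp_trigPoly_le {p : ℝ≥0∞} (hp : 1 ≤ p) {N : ℕ} (hN : 0 < N) (Θ : Finset ℤ)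
    (hΘ : ∀ n ∈ Θ, n.natAbs ≤ N) (c : ℤ → ℂ) (h : ℝ) (k : ℕ) :
    torusNorm p (diffOp k h (trigPoly Θ c)) ≤
      ENNReal.ofReal ((2 * min 1 (N * |h|)) ^ k) * torusNorm p (trigPoly Θ c) := by
  have h0 : 0 ≤ min 1 (N * |h|) := le_min zero_le_one (by positivity)
  induction k generalizing c with
  | zero => simp [diffOp]
  | succ k ih =>
    rw [diffOp, Function.iterate_succ_apply, translate_sub_trigPoly, ← diffOp]
    refine (ih _).trans ?_
    rw [← translate_sub_trigPoly, pow_succ, ENNReal.ofReal_mul (by positivity), mul_assoc]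
    gcongr
    exact torusNorm_translate_sub_le_min hp hN Θ hΘ c h

lemma modulus_trigPoly_le {p : ℝ≥0∞} (hp : 1 ≤ p) {N : ℕ} (hN : 0 < N) (Θ : Finset ℤ)
    (hΘ : ∀ n ∈ Θ, n.natAbs ≤ N) (c : ℤ → ℂ) {B : ℝ}
    (hB : torusNorm p (trigPoly Θ c) ≤ ENNReal.ofReal B) (k : ℕ) {t : ℝ} (ht : 0 ≤ t) :
    modulus k p (trigPoly Θ c) t ≤ ENNReal.ofReal (2 ^ k * B * (min 1 (N * t)) ^ k) := by
  refine iSup₂_le fun h hh => ?_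
  refine (torusNorm_diffOp_trigPoly_le hp hN Θ hΘ c h k).trans ?_
  have h0 : 0 ≤ min 1 (N * |h|) := le_min zero_le_one (by positivity)
  have h1 : min 1 (N * |h|) ≤ min 1 (N * t) := by gcongr
  have e : 2 ^ k * B * (min 1 (N * t)) ^ k = (2 * min 1 (N * t)) ^ k * B := by
    rw [mul_pow]; ring
  rw [e, ENNReal.ofReal_mul (by positivity)]
  gcongr

/-- The Besov seminorm of a trigonometric polynomial of degree at most `N` is at most `N^r` times
its `L_p` norm, up to a constant. -/
theorem exists_besovSeminorm_trigPoly_le {k : ℕ} {r : ℝ} (hr : 0 < r) (hk : r < k) {θ : ℝ≥0∞}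
    (hθ : 1 ≤ θ) : ∃ K : ℝ, 0 < K ∧ ∀ (p : ℝ≥0∞), 1 ≤ p → ∀ N : ℕ, 0 < N → ∀ (Θ : Finset ℤ),
      (∀ n ∈ Θ, n.natAbs ≤ N) → ∀ (c : ℤ → ℂ) (B : ℝ), 0 ≤ B →
      torusNorm p (trigPoly Θ c) ≤ ENNReal.ofReal B →
      besovSeminorm k r p θ (trigPoly Θ c) ≤ ENNReal.ofReal (K * (N : ℝ) ^ r * B) := by
  have hkr : 0 < k - r := by linarith
  by_cases hθT : θ = ∞
  · refine ⟨2 ^ k, by positivity, fun p hp N hN Θ hΘ c B hB0 hB => ?_⟩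
    rw [besovSeminorm, if_pos hθT]
    refine iSup₂_le fun t ht => ?_
    have hN' : (0 : ℝ) < N := by exact_mod_cast hN
    refine (mul_le_mul_right (modulus_trigPoly_le hp hN Θ hΘ c hB k ht.le) _).trans ?_
    rw [← ENNReal.ofReal_mul (by positivity)]
    refine ENNReal.ofReal_le_ofReal ?_
    have hu : 0 < N * t := by positivity
    have h1 : t ^ (-r) = (N : ℝ) ^ r * (N * t) ^ (-r) := by
      rw [Real.mul_rpow hN'.le ht.le, ← mul_assoc, ← Real.rpow_add hN', add_neg_cancel,
        Real.rpow_zero, one_mul]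
    have h2 : (N * t) ^ (-r) * (min 1 (N * t)) ^ k ≤ 1 := by
      rcases le_total 1 (N * t) with h | h
      · rw [min_eq_left h, one_pow, mul_one]
        exact Real.rpow_le_one_of_one_le_of_nonpos h (by linarith)
      · rw [min_eq_right h, ← Real.rpow_natCast, ← Real.rpow_add hu]
        exact Real.rpow_le_one hu.le h (by linarith)
    calc t ^ (-r) * (2 ^ k * B * (min 1 (N * t)) ^ k)
        = 2 ^ k * (N : ℝ) ^ r * B * ((N * t) ^ (-r) * (min 1 (N * t)) ^ k) := by rw [h1]; ring
      _ ≤ 2 ^ k * (N : ℝ) ^ r * B * 1 := by gcongr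
      _ = _ := mul_one _
  · have hθ0 : θ ≠ 0 := (zero_lt_one.trans_le hθ).ne'
    set τ := θ.toReal with hτ
    have hτ0 : 0 < τ := ENNReal.toReal_pos hθ0 hθT
    set a := (k - r) * τ with ha
    set b := r * τ with hb
    have ha0 : 0 < a := by positivity
    have hb0 : 0 < b := by positivity
    refine ⟨2 ^ k * (1 / a + 1 / b) ^ (1 / τ), by positivity, fun p hp N hN Θ hΘ c B hB0 hB => ?_⟩
    rw [besovSeminorm, if_neg hθT]
    have hN' : (0 : ℝ) < N := by exact_mod_cast hN
    set A := 2 ^ k * B with hA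
    have hA0 : 0 ≤ A := by positivity
    have hd : (0 : ℝ) < 1 / N := by positivity
    have hmod := fun t ht => modulus_trigPoly_le hp hN Θ hΘ c hB k (t := t) ht
    set F : ℝ → ℝ≥0∞ := fun t => (ENNReal.ofReal (t ^ (-r)) * modulus k p (trigPoly Θ c) t) ^ τ *
      ENNReal.ofReal (1 / t) with hF
    have hFle : ∀ t : ℝ, 0 < t → ∀ y : ℝ, 0 ≤ y → t ^ (-r) * (A * (min 1 (N * t)) ^ k) ≤ y →
        F t ≤ ENNReal.ofReal (y ^ τ * (1 / t)) := by
      intro t ht y hy hy1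
      rw [ENNReal.ofReal_mul (by positivity), ← ENNReal.ofReal_rpow_of_nonneg hy hτ0.le]
      refine mul_le_mul' (ENNReal.rpow_le_rpow ?_ hτ0.le) le_rfl
      refine (mul_le_mul_right (hmod t ht.le) _).trans ?_
      rw [← ENNReal.ofReal_mul (by positivity)]
      exact ENNReal.ofReal_le_ofReal hy1
    have hI1 : ∫⁻ t in Set.Ioc 0 (1 / (N : ℝ)), F t ≤ ENNReal.ofReal (A ^ τ * (N : ℝ) ^ b * (1 / a)) := by
      have hint : IntervalIntegrable (fun t : ℝ => t ^ (a - 1)) volume 0 (1 / N) :=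
        intervalIntegral.intervalIntegrable_rpow' (by linarith)
      calc _ ≤ ∫⁻ t in Set.Ioc 0 (1 / (N : ℝ)),
            ENNReal.ofReal ((A * N ^ k) ^ τ * t ^ (a - 1)) := by
            refine setLIntegral_mono' measurableSet_Ioc fun t ht => ?_
            have ht0 := ht.1
            refine (hFle t ht0 (A * N ^ k * t ^ (k - r)) (by positivity) ?_).trans
              (ENNReal.ofReal_le_ofReal (le_of_eq ?_))
            · have h1 : N * t ≤ 1 := by
                have := ht.2
                rw [le_div_iff₀ hN'] at this; linarith
              rw [min_eq_right h1, mul_pow, sub_eq_neg_add, Real.rpow_add ht0, Real.rpow_natCast]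
              exact le_of_eq (by ring)
            · rw [Real.mul_rpow (by positivity) (by positivity), ← Real.rpow_mul ht0.le, ← ha,
                Real.rpow_sub ht0, Real.rpow_one]
              ring
        _ = ENNReal.ofReal (∫ t in (0 : ℝ)..(1 / N), (A * N ^ k) ^ τ * t ^ (a - 1)) := by
            rw [intervalIntegral.integral_of_le hd.le, ofReal_integral_eq_lintegral_ofReal]
            · exact (hint.const_mul _).1
            · refine (ae_restrict_iff' measurableSet_Ioc).2 (Filter.Eventually.of_forall ?_)
              intro t ht
              have := ht.1
              simp only [Pi.zero_apply]; positivity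
        _ = _ := by
            congr 1
            rw [intervalIntegral.integral_const_mul, integral_rpow (Or.inl (by linarith)),
              sub_add_cancel, Real.zero_rpow ha0.ne', sub_zero,
              Real.mul_rpow hA0 (by positivity), ← Real.rpow_natCast, ← Real.rpow_mul hN'.le,
              one_div (N : ℝ), Real.inv_rpow hN'.le, ← Real.rpow_neg hN'.le]
            have : (N : ℝ) ^ b = (N : ℝ) ^ (k * τ) * (N : ℝ) ^ (-a) := by
              rw [← Real.rpow_add hN']; congr 1; rw [ha, hb]; ring
            rw [this]; ring
    have hI2 : ∫⁻ t in Set.Ioi (1 / (N : ℝ)), F t ≤ ENNReal.ofReal (A ^ τ * (N : ℝ) ^ b * (1 / b)) := by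
      calc _ ≤ ∫⁻ t in Set.Ioi (1 / (N : ℝ)), ENNReal.ofReal (A ^ τ * t ^ (-b - 1)) := by
            refine setLIntegral_mono' measurableSet_Ioi fun t ht => ?_
            have ht0 : 0 < t := hd.trans ht
            refine (hFle t ht0 (A * t ^ (-r)) (by positivity) ?_).trans
              (ENNReal.ofReal_le_ofReal (le_of_eq ?_))
            · rw [mul_comm]
              refine mul_le_mul_of_nonneg_right ?_ (by positivity)
              refine mul_le_of_le_one_right hA0 (pow_le_one₀ ?_ (min_le_left _ _))
              exact le_min zero_le_one (by positivity)
            · rw [Real.mul_rpow hA0 (by positivity), ← Real.rpow_mul ht0.le, neg_mul, ← hb,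
                Real.rpow_sub ht0, Real.rpow_one]
              ring
        _ = ENNReal.ofReal (∫ t in Set.Ioi (1 / (N : ℝ)), A ^ τ * t ^ (-b - 1)) := by
            rw [ofReal_integral_eq_lintegral_ofReal]
            · exact (integrableOn_Ioi_rpow_of_lt (by linarith) hd).const_mul _
            · refine (ae_restrict_iff' measurableSet_Ioi).2 (Filter.Eventually.of_forall ?_)
              intro t ht
              have : 0 < t := hd.trans ht
              simp only [Pi.zero_apply]; positivity
        _ = _ := by
            congr 1
            rw [integral_const_mul, integral_Ioi_rpow_of_lt (by linarith) hd, sub_add_cancel,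
              neg_div_neg_eq, one_div (N : ℝ), Real.inv_rpow hN'.le, ← Real.rpow_neg hN'.le, neg_neg]
            ring
    have hI : ∫⁻ t in Set.Ioi (0 : ℝ), F t ≤
        ENNReal.ofReal (A ^ τ * (N : ℝ) ^ b * (1 / a + 1 / b)) := by
      rw [← Set.Ioc_union_Ioi_eq_Ioi hd.le]
      refine (lintegral_union_le _ _ _).trans ((add_le_add hI1 hI2).trans (le_of_eq ?_))
      rw [← ENNReal.ofReal_add (by positivity) (by positivity)]
      congr 1; ring
    refine (ENNReal.rpow_le_rpow hI (by positivity)).trans (le_of_eq ?_)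
    rw [ENNReal.ofReal_rpow_of_nonneg (by positivity) (by positivity)]
    congr 1
    rw [Real.mul_rpow (by positivity) (by positivity), Real.mul_rpow (by positivity) (by positivity),
      ← Real.rpow_mul hA0, mul_one_div_cancel hτ0.ne', Real.rpow_one, ← Real.rpow_mul hN'.le, hb,
      mul_assoc r, mul_one_div_cancel hτ0.ne', mul_one, hA]
    ring

end BesovPoly

section FlatPolynomials

/-- Rudin–Shapiro polynomials. -/
lemma exists_rudinShapiro (q : ℕ) : ∃ a b : ℤ → ℂ, (∀ n, ‖a n‖ = 1) ∧ (∀ n, ‖b n‖ = 1) ∧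
    ∀ x, ‖trigPoly (Finset.Ico 0 (2 ^ q)) a x‖ ^ 2 + ‖trigPoly (Finset.Ico 0 (2 ^ q)) b x‖ ^ 2 =
      2 * 2 ^ q := by
  induction q with
  | zero =>
    refine ⟨fun _ => 1, fun _ => 1, by simp, by simp, fun x => ?_⟩
    have : Finset.Ico (0 : ℤ) (2 ^ 0) = {0} := by ext; simp; omega
    rw [this]
    simp only [trigPoly, Finset.sum_singleton, fourier_zero_apply]
    norm_num
  | succ q ih =>
    obtain ⟨a, b, ha, hb, hab⟩ := ih
    have hsplit : ∀ (σ : ℂ) (x : Torus), trigPoly (Finset.Ico 0 (2 ^ (q + 1)))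
        (fun n => if n < 2 ^ q then a n else σ * b (n - 2 ^ q)) x =
        trigPoly (Finset.Ico 0 (2 ^ q)) a x +
          σ * (fourier (2 ^ q) x * trigPoly (Finset.Ico 0 (2 ^ q)) b x) := by
      intro σ x
      have h0 : (0 : ℤ) ≤ 2 ^ q := by positivity
      have hu : Finset.Ico (0 : ℤ) (2 ^ (q + 1)) = Finset.Ico 0 (2 ^ q) ∪
          (Finset.Ico 0 (2 ^ q)).image (fun n => n + 2 ^ q) := by
        ext n
        have : (2 : ℤ) ^ (q + 1) = 2 ^ q + 2 ^ q := by ring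
        simp only [Finset.mem_Ico, Finset.mem_union, Finset.mem_image, this]
        constructor
        · intro h
          by_cases h1 : n < 2 ^ q
          · exact Or.inl ⟨h.1, h1⟩
          · exact Or.inr ⟨n - 2 ^ q, by omega, by omega⟩
        · rintro (h | ⟨m, h, rfl⟩) <;> omega
      have hd : Disjoint (Finset.Ico (0 : ℤ) (2 ^ q))
          ((Finset.Ico 0 (2 ^ q)).image (fun n => n + 2 ^ q)) := by
        rw [Finset.disjoint_left]
        intro n h1 h2
        obtain ⟨m, h3, rfl⟩ := Finset.mem_image.1 h2
        rw [Finset.mem_Ico] at h1 h3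
        omega
      simp only [trigPoly]
      rw [hu, Finset.sum_union hd, Finset.sum_image (by intro i _ j _ h; exact add_right_cancel h)]
      congr 1
      · refine Finset.sum_congr rfl fun n hn => ?_
        rw [if_pos (Finset.mem_Ico.1 hn).2]
      · rw [Finset.mul_sum, Finset.mul_sum]
        refine Finset.sum_congr rfl fun n hn => ?_
        have := (Finset.mem_Ico.1 hn).1
        rw [if_neg (by omega), add_sub_cancel_right, fourier_add]
        ring
    refine ⟨fun n => if n < 2 ^ q then a n else 1 * b (n - 2 ^ q),
      fun n => if n < 2 ^ q then a n else -1 * b (n - 2 ^ q), fun n => ?_, fun n => ?_, fun x => ?_⟩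
    · dsimp only; split_ifs <;> simp [ha, hb]
    · dsimp only; split_ifs <;> simp [ha, hb]
    · rw [hsplit, hsplit, one_mul, neg_one_mul, ← sub_eq_add_neg]
      have h1 := parallelogram_law_with_norm ℝ (trigPoly (Finset.Ico 0 (2 ^ q)) a x)
        (fourier (2 ^ q) x * trigPoly (Finset.Ico 0 (2 ^ q)) b x)
      rw [norm_mul, norm_fourier_apply, one_mul] at h1
      have h2 := hab x
      have h3 : (2 : ℝ) ^ (q + 1) = 2 * 2 ^ q := by ring
      rw [h3]
      linarith

lemma exists_flat_trigPoly_of_two_le {p : ℝ≥0∞} (q : ℕ) :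
    ∃ (Θ Γ : Finset ℤ) (c : ℤ → ℂ), Γ ⊆ Θ ∧ (∀ n ∈ Θ, n.natAbs ≤ 2 ^ q) ∧ 2 ^ q ≤ Γ.card ∧
      (∀ n ∈ Γ, 1 / 2 ≤ ‖c n‖) ∧
      torusNorm p (trigPoly Θ c) ≤ ENNReal.ofReal (2 * ((2 : ℝ) ^ q) ^ (1 / 2 : ℝ)) := by
  obtain ⟨a, b, ha, hb, hab⟩ := exists_rudinShapiro q
  refine ⟨Finset.Ico 0 (2 ^ q), _, a, subset_rfl, fun n hn => ?_, ?_, fun n _ => ?_, ?_⟩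
  · have := Finset.mem_Ico.1 hn
    zify
    rw [abs_of_nonneg this.1]
    exact this.2.le
  · rw [Int.card_Ico, sub_zero]
    zify
    rw [Int.toNat_of_nonneg (by positivity)]
  · rw [ha]; norm_num
  · refine torusNorm_le_of_bound p fun x => ?_
    rw [← Real.sqrt_eq_rpow]
    have h1 := hab x
    have h2 : (0 : ℝ) ≤ 2 ^ q := by positivity
    refine abs_le_of_sq_le_sq' ?_ (by positivity) |>.2
    rw [mul_pow, Real.sq_sqrt h2]
    nlinarith [sq_nonneg ‖trigPoly (Finset.Ico 0 (2 ^ q)) b x‖]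

lemma exists_flat_trigPoly_of_le_two {p : ℝ≥0∞} (hp : 1 ≤ p) {N : ℕ} (hN : 0 < N) :
    ∃ (Θ Γ : Finset ℤ) (c : ℤ → ℂ), Γ ⊆ Θ ∧ (∀ n ∈ Θ, n.natAbs ≤ N) ∧ N ≤ Γ.card ∧
      (∀ n ∈ Γ, 1 / 2 ≤ ‖c n‖) ∧
      torusNorm p (trigPoly Θ c) ≤ ENNReal.ofReal ((N : ℝ) ^ (1 - (1 / p).toReal)) := by
  have hN' : (0 : ℝ) < N := by exact_mod_cast hN
  set Θ := Finset.Icc (-(N : ℤ)) N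
  set c : ℤ → ℂ := fun n => (N : ℂ)⁻¹ * ((N - n.natAbs : ℕ) : ℂ) with hc
  have hF : ∀ x, trigPoly Θ c x = (N : ℂ)⁻¹ * fejerSum N x := by
    intro x
    rw [fejerSum_eq_sum N le_rfl, Finset.mul_sum]
    exact Finset.sum_congr rfl fun n _ => by rw [hc]; ring
  have hnF : ∀ x, ‖trigPoly Θ c x‖ = (N : ℝ)⁻¹ * ‖fejerSum N x‖ := fun x => by
    rw [hF, norm_mul, norm_inv, Complex.norm_natCast]
  refine ⟨Θ, Finset.Icc (-(N / 2 : ℕ) : ℤ) (N / 2 : ℕ), c, ?_, fun n hn => ?_, ?_, fun n hn => ?_, ?_⟩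
  · exact Finset.Icc_subset_Icc (by omega) (by omega)
  · have := Finset.mem_Icc.1 hn; omega
  · rw [Int.card_Icc]; omega
  · have h1 := Finset.mem_Icc.1 hn
    have h2 : N ≤ 2 * (N - n.natAbs) := by omega
    have h3 : (N : ℝ) ≤ 2 * ((N - n.natAbs : ℕ) : ℝ) := by exact_mod_cast h2
    rw [hc]
    simp only [norm_mul, norm_inv, Complex.norm_natCast]
    rw [inv_mul_eq_div, div_le_div_iff₀ (by norm_num) hN']
    linarith
  · have hM : ∀ x, ‖trigPoly Θ c x‖ ≤ N := by
      intro x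
      have h1 : ‖∑ a ∈ Finset.range N, fourier (a : ℤ) x‖ ≤ N := by
        refine (norm_sum_le _ _).trans (le_of_eq ?_)
        simp only [norm_fourier_apply]; simp
      rw [hnF, fejerSum_eq_normSq, Complex.norm_real, Real.norm_of_nonneg (Complex.normSq_nonneg _),
        Complex.normSq_eq_norm_sq, inv_mul_eq_div, div_le_iff₀ hN']
      nlinarith [norm_nonneg (∑ a ∈ Finset.range N, fourier (a : ℤ) x)]
    have h1 : torusNorm 1 (trigPoly Θ c) ≤ 1 := by
      have hm := (memLp_one_iff_integrable.2 (integrable_trigPoly Θ c)).eLpNorm_eq_integral_rpow_norm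
        one_ne_zero ENNReal.one_ne_top
      rw [torusNorm, hm]
      simp only [ENNReal.toReal_one, Real.rpow_one, inv_one, hnF]
      rw [integral_const_mul]
      have h2 : ∫ t : Torus, ‖fejerSum N t‖ ∂AddCircle.haarAddCircle = N := by
        rw [← integral_norm_fejerSum N 0, integral_sub_left_eq_self (fun t => ‖fejerSum N t‖)]
      rw [h2, inv_mul_cancel₀ hN'.ne', ENNReal.ofReal_one]
    refine (torusNorm_le_interp (a := 1) one_ne_zero hp ENNReal.one_ne_top hM).trans ?_
    rw [← ENNReal.toReal_div]
    have h3 : (1 / p).toReal ≤ 1 := by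
      have : (1 / p).toReal ≤ (1 : ℝ≥0∞).toReal := by
        refine ENNReal.toReal_mono ENNReal.one_ne_top ?_
        rw [one_div]; exact ENNReal.inv_le_one.2 hp
      simpa using this
    rw [← ENNReal.ofReal_rpow_of_nonneg hN'.le (by linarith)]
    refine mul_le_of_le_one_right' ?_
    exact (ENNReal.rpow_le_rpow h1 ENNReal.toReal_nonneg).trans_eq (ENNReal.one_rpow _)

/-- Trigonometric polynomials of degree `2^q` with at least `2^q` coefficients of size at least
`1/2` and the smallest possible order of the `L_p` norm. -/
lemma exists_flat_trigPoly {p : ℝ≥0∞} (hp : 1 ≤ p) (q : ℕ) :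
    ∃ (Θ Γ : Finset ℤ) (c : ℤ → ℂ), Γ ⊆ Θ ∧ (∀ n ∈ Θ, n.natAbs ≤ 2 ^ q) ∧ 2 ^ q ≤ Γ.card ∧
      (∀ n ∈ Γ, 1 / 2 ≤ ‖c n‖) ∧ torusNorm p (trigPoly Θ c) ≤
        ENNReal.ofReal (2 * ((2 : ℝ) ^ q) ^ (1 / 2 - max ((1 / p).toReal - 1 / 2) 0)) := by
  rcases le_total ((1 / p).toReal) (1 / 2) with h | h
  · obtain ⟨Θ, Γ, c, h1, h2, h3, h4, h5⟩ := exists_flat_trigPoly_of_two_le (p := p) q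
    refine ⟨Θ, Γ, c, h1, h2, h3, h4, ?_⟩
    rwa [max_eq_right (by linarith), sub_zero]
  · obtain ⟨Θ, Γ, c, h1, h2, h3, h4, h5⟩ :=
      exists_flat_trigPoly_of_le_two hp (N := 2 ^ q) (by positivity)
    refine ⟨Θ, Γ, c, h1, h2, h3, h4, h5.trans (ENNReal.ofReal_le_ofReal ?_)⟩
    rw [max_eq_left (by linarith)]
    push_cast
    have : 1 / 2 - ((1 / p).toReal - 1 / 2) = 1 - (1 / p).toReal := by ring
    rw [this]
    have : 0 ≤ ((2 : ℝ) ^ q) ^ (1 - (1 / p).toReal) := by positivity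
    linarith

end FlatPolynomials

section Lower

lemma vpSum_trigPoly_eq_self {l : ℕ} (hl : 0 < l) (Θ : Finset ℤ) (c : ℤ → ℂ)
    (hΘ : ∀ n ∈ Θ, n.natAbs ≤ l) : vpSum l (trigPoly Θ c) = trigPoly Θ c := by
  rw [vpSum_eq_trigPoly l (integrable_trigPoly Θ c), trigPoly_subset (Θ := Θ)]
  · ext x
    refine Finset.sum_congr rfl fun n hn => ?_
    simp only [vpCoeff_eq_one hl (hΘ n hn), fourierCoeff_trigPoly, if_pos hn, one_mul]
  · intro n hn
    have := hΘ n hn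
    rw [Finset.mem_Icc]; omega
  · intro n _ hn
    rw [fourierCoeff_trigPoly, if_neg hn, mul_zero]

lemma sum_sigmaBlock (S : ℕ) (f : Torus → ℂ) (x : Torus) :
    ∑ s ∈ Finset.range (S + 1), sigmaBlock s f x = vpSum (2 ^ S) f x := by
  induction S with
  | zero => simp [sigmaBlock]
  | succ S ih => rw [Finset.sum_range_succ, ih]; simp [sigmaBlock]

lemma torusNorm_two_le_bqOneNorm (Θ : Finset ℤ) (c : ℤ → ℂ) :
    torusNorm 2 (trigPoly Θ c) ≤ bqOneNorm ∞ (trigPoly Θ c) := by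
  obtain ⟨S, hS⟩ : ∃ S : ℕ, ∀ n ∈ Θ, n.natAbs ≤ 2 ^ S := by
    refine ⟨∑ n ∈ Θ, n.natAbs, fun n hn => ?_⟩
    exact (Finset.single_le_sum (f := Int.natAbs) (fun _ _ => Nat.zero_le _) hn).trans
      Nat.lt_two_pow_self.le
  have hi := integrable_trigPoly Θ c
  have h1 : trigPoly Θ c = ∑ s ∈ Finset.range (S + 1), sigmaBlock s (trigPoly Θ c) := by
    ext x
    rw [Finset.sum_apply, sum_sigmaBlock, vpSum_trigPoly_eq_self (by positivity) Θ c hS]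
  calc torusNorm 2 (trigPoly Θ c) ≤ torusNorm ∞ (trigPoly Θ c) :=
        eLpNorm_le_eLpNorm_of_exponent_le le_top (continuous_trigPoly _ _).aestronglyMeasurable
    _ = torusNorm ∞ (∑ s ∈ Finset.range (S + 1), sigmaBlock s (trigPoly Θ c)) := by rw [← h1]
    _ ≤ ∑ s ∈ Finset.range (S + 1), torusNorm ∞ (sigmaBlock s (trigPoly Θ c)) := by
        refine eLpNorm_sum_le (fun s _ => ?_) le_top
        rw [sigmaBlock_eq_trigPoly s hi]
        exact (continuous_trigPoly _ _).aestronglyMeasurable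
    _ ≤ _ := ENNReal.sum_le_tsum _

lemma le_bestMTerm_trigPoly (Θ Γ : Finset ℤ) (hΓ : Γ ⊆ Θ) (c : ℤ → ℂ) {δ : ℝ} (hδ : 0 ≤ δ)
    (hc : ∀ n ∈ Γ, δ ≤ ‖c n‖) (m : ℕ) :
    ENNReal.ofReal (√((Γ.card - m : ℝ) * δ ^ 2)) ≤ bestMTerm (bqOneNorm ∞) m (trigPoly Θ c) := by
  classical
  refine le_iInf₂ fun Θ' hΘ' => le_iInf fun c' => ?_
  set e : ℤ → ℂ := fun n => (if n ∈ Θ then c n else 0) - if n ∈ Θ' then c' n else 0 with he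
  have h1 : (fun x => trigPoly Θ c x - trigPoly Θ' c' x) = trigPoly (Θ ∪ Θ') e := by
    have h2 : trigPoly (Θ ∪ Θ') (fun n => if n ∈ Θ then c n else 0) = trigPoly Θ c := by
      rw [trigPoly_subset Finset.subset_union_left _ fun n _ h => if_neg h]
      ext x
      exact Finset.sum_congr rfl fun n hn => by simp only [if_pos hn]
    have h3 : trigPoly (Θ ∪ Θ') (fun n => if n ∈ Θ' then c' n else 0) = trigPoly Θ' c' := by
      rw [trigPoly_subset Finset.subset_union_right _ fun n _ h => if_neg h]
      ext x
      exact Finset.sum_congr rfl fun n hn => by simp only [if_pos hn]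
    rw [← h2, ← h3]
    ext x
    simp only [trigPoly, he, ← Finset.sum_sub_distrib, sub_mul]
  rw [h1]
  refine le_trans ?_ (torusNorm_two_le_bqOneNorm _ _)
  rw [torusNorm_two_trigPoly]
  refine ENNReal.ofReal_le_ofReal (Real.sqrt_le_sqrt ?_)
  have hcard : (Γ.card - m : ℝ) ≤ (Γ \ Θ').card := by
    have : Γ.card ≤ (Γ \ Θ').card + m := by
      rw [← hΘ']
      exact (Finset.card_le_card_sdiff_add_card)
    have : (Γ.card : ℝ) ≤ (Γ \ Θ').card + m := by exact_mod_cast this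
    linarith
  calc (Γ.card - m : ℝ) * δ ^ 2 ≤ (Γ \ Θ').card * δ ^ 2 :=
        mul_le_mul_of_nonneg_right hcard (by positivity)
    _ = ∑ n ∈ Γ \ Θ', δ ^ 2 := by rw [Finset.sum_const, nsmul_eq_mul]
    _ ≤ ∑ n ∈ Γ \ Θ', ‖e n‖ ^ 2 := by
        refine Finset.sum_le_sum fun n hn => ?_
        obtain ⟨h2, h3⟩ := Finset.mem_sdiff.1 hn
        simp only [he, if_pos (hΓ h2), if_neg h3, sub_zero]
        exact pow_le_pow_left₀ hδ (hc n h2) 2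
    _ ≤ _ := Finset.sum_le_sum_of_subset_of_nonneg
        (fun n hn => Finset.mem_union_left _ (hΓ (Finset.mem_sdiff.1 hn).1)) fun _ _ _ => by positivity

/-- The lower bound for best `m`-term approximation of the Besov class. -/
theorem exists_le_bestMTermClass {k : ℕ} {r : ℝ} (hk : r < k) {p θ : ℝ≥0∞} (hp : 1 ≤ p)
    (hθ : 1 ≤ θ) (hr : 0 < r) (hγr : max ((1 / p).toReal - 1 / 2) 0 ≤ r) :
    ∃ C₁ : ℝ, 0 < C₁ ∧ ∀ m : ℕ, 1 ≤ m →
      ENNReal.ofReal (C₁ * (m : ℝ) ^ (-r + max ((1 / p).toReal - 1 / 2) 0)) ≤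
        bestMTermClass (bqOneNorm ∞) m (besovClass k r p θ) := by
  set γ := max ((1 / p).toReal - 1 / 2) 0
  obtain ⟨K, hK, hKB⟩ := exists_besovSeminorm_trigPoly_le hr hk hθ
  refine ⟨1 / (8 * (K + 1)) * 4 ^ (-r + γ), by positivity, fun m hm => ?_⟩
  have hm0 : (0 : ℝ) < m := by exact_mod_cast hm
  set q := Nat.log 2 m + 2 with hq
  have hq1 : 2 ^ Nat.log 2 m ≤ m := Nat.pow_log_le_self 2 (by omega)
  have hq2 : m < 2 ^ (Nat.log 2 m + 1) := Nat.lt_pow_succ_log_self (by norm_num) m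
  have hqm : 2 * m ≤ 2 ^ q := by rw [hq, pow_succ]; omega
  have hqm' : 2 ^ q ≤ 4 * m := by rw [hq, pow_add]; omega
  have hqmR : 2 * (m : ℝ) ≤ 2 ^ q := by exact_mod_cast hqm
  have hqmR' : (2 : ℝ) ^ q ≤ 4 * m := by exact_mod_cast hqm'
  obtain ⟨Θ, Γ, c, hΓΘ, hdeg, hcard, hc, hnorm⟩ := exists_flat_trigPoly hp q
  set N : ℝ := (2 : ℝ) ^ q with hN
  have hN0 : 0 < N := by positivity
  have hN1 : 1 ≤ N := one_le_pow₀ (by norm_num)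
  set B := 2 * N ^ (1 / 2 - γ)
  have hB0 : 0 < B := by positivity
  set lam : ℝ := 1 / ((K + 1) * N ^ r * B) with hlam
  have hlam0 : 0 < lam := by positivity
  set c' : ℤ → ℂ := fun n => (lam : ℂ) * c n with hc'
  have hsmul : trigPoly Θ c' = (lam : ℂ) • trigPoly Θ c := by
    ext x
    simp only [trigPoly, hc', Pi.smul_apply, smul_eq_mul, Finset.mul_sum, mul_assoc]
  have hnorm' : torusNorm p (trigPoly Θ c') ≤ ENNReal.ofReal (lam * B) := by
    rw [hsmul, torusNorm, eLpNorm_const_smul, ← ofReal_norm, Complex.norm_real,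
      Real.norm_of_nonneg hlam0.le, ENNReal.ofReal_mul hlam0.le]
    gcongr
    exact hnorm
  have hmem : trigPoly Θ c' ∈ besovClass k r p θ := by
    refine ⟨⟨(continuous_trigPoly _ _).aestronglyMeasurable,
      hnorm'.trans_lt ENNReal.ofReal_lt_top⟩, ?_⟩
    refine (add_le_add hnorm' (hKB p hp (2 ^ q) (by positivity) Θ hdeg c' (lam * B) (by positivity)
      hnorm')).trans ?_
    rw [← ENNReal.ofReal_add (by positivity) (by positivity), ENNReal.ofReal_le_one]
    push_cast
    rw [← hN]
    have h1 : 1 ≤ N ^ r := Real.one_le_rpow hN1 hr.le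
    have h2 : lam * B * ((K + 1) * N ^ r) = 1 := by rw [hlam]; field_simp
    have h3 : 0 ≤ lam * B := by positivity
    nlinarith
  have hlow := le_bestMTerm_trigPoly Θ Γ hΓΘ c' (δ := lam / 2) (by positivity) (fun n hn => by
    rw [hc', norm_mul, Complex.norm_real, Real.norm_of_nonneg hlam0.le]
    have := hc n hn
    nlinarith) m
  refine le_trans ?_ (le_iSup₂_of_le _ hmem hlow)
  refine ENNReal.ofReal_le_ofReal ?_
  have hcardR : N ≤ Γ.card := by rw [hN]; exact_mod_cast hcard
  have h1 : N / 4 ≤ (Γ.card - m : ℝ) := by linarith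
  have h2 : √N / 2 * (lam / 2) ≤ √((Γ.card - m : ℝ) * (lam / 2) ^ 2) := by
    refine Real.le_sqrt_of_sq_le ?_
    rw [mul_pow, div_pow, Real.sq_sqrt hN0.le]
    refine mul_le_mul_of_nonneg_right ?_ (by positivity)
    linarith
  refine le_trans ?_ h2
  have h3 : √N / 2 * (lam / 2) = 1 / (8 * (K + 1)) * N ^ (-r + γ) := by
    have h4 : N ^ (-r + γ) * (N ^ r * N ^ (1 / 2 - γ)) = √N := by
      rw [← Real.rpow_add hN0, ← Real.rpow_add hN0, Real.sqrt_eq_rpow]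
      congr 1; ring
    have h5 : N ^ r ≠ 0 := by positivity
    have h6 : N ^ (1 / 2 - γ) ≠ 0 := by positivity
    rw [hlam, ← h4]
    simp only [B]
    field_simp
    norm_num
  rw [h3, mul_assoc, ← Real.mul_rpow (by norm_num) hm0.le]
  refine mul_le_mul_of_nonneg_left ?_ (by positivity)
  exact Real.rpow_le_rpow_of_nonpos hN0 hqmR' (by linarith)

end Lower

end TrigApprox

end

theorem theorem3 (p θ : ℝ≥0∞) (hp : 1 ≤ p) (hθ : 1 ≤ θ) (r : ℝ)
    (hr : max (1 / p).toReal (1 / 2) < r) (k : ℕ) (hk : r < (k : ℝ)) :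
    TrigApprox.besovClass k r p θ ⊆ TrigApprox.bqOneSpace ∞ ∧
    ∃ C₁ C₂ : ℝ, 0 < C₁ ∧ 0 < C₂ ∧ ∀ m : ℕ, 1 ≤ m →
      ENNReal.ofReal (C₁ * (m : ℝ) ^ (-r + max ((1 / p).toReal - 1 / 2) 0)) ≤
          TrigApprox.bestMTermClass (TrigApprox.bqOneNorm ∞) m (TrigApprox.besovClass k r p θ) ∧
      TrigApprox.bestMTermClass (TrigApprox.bqOneNorm ∞) m (TrigApprox.besovClass k r p θ) ≤
          ENNReal.ofReal (C₂ * (m : ℝ) ^ (-r + max ((1 / p).toReal - 1 / 2) 0)) := by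
  have hr1 : (1 / p).toReal < r := (le_max_left _ _).trans_lt hr
  have hr2 : 1 / 2 < r := (le_max_right _ _).trans_lt hr
  have hr0 : 0 < r := by linarith
  set γ := max ((1 / p).toReal - 1 / 2) 0 with hγ
  have hγr : γ < r - 1 / 2 := max_lt (by linarith) (by linarith)
  set κ := r - γ - 1 / 2 with hκ
  have hκ0 : 0 < κ := by linarith
  set C := TrigApprox.blockConst k r
  have hC : 0 < C := zero_lt_one.trans_le (TrigApprox.one_le_blockConst k hr0.le)
  have hblock : ∀ f ∈ TrigApprox.besovClass k r p θ, ∀ j : ℕ,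
      ∑ n ∈ TrigApprox.dyadicBlock j, ‖fourierCoeff f n‖ ≤ C * 2 ^ (-κ * j) :=
    fun f hf j => TrigApprox.sum_dyadicBlock_le hr0.le hp hθ hf j
  refine ⟨fun f hf => ?_, ?_⟩
  · have hfi := TrigApprox.integrable_of_inLp hp hf.1
    have hq1 : (2 : ℝ) ^ (-κ) < 1 :=
      Real.rpow_lt_one_of_one_lt_of_neg (by norm_num) (by linarith)
    have H : ∀ j : ℕ, ∑ n ∈ TrigApprox.dyadicBlock j, ‖fourierCoeff f n‖ ≤
        C * ((2 : ℝ) ^ (-κ)) ^ j := fun j => by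
      rw [← Real.rpow_natCast, ← Real.rpow_mul (by norm_num)]
      exact hblock f hf j
    exact ⟨TrigApprox.memLp_top_of_summable_fourierCoeff hfi
      (TrigApprox.summable_norm_fourierCoeff_of_dyadicBlock (by positivity) hq1 hC H),
      (TrigApprox.bqOneNorm_le_of_dyadicBlock hfi (by positivity) hq1 H).trans_lt
        ENNReal.ofReal_lt_top⟩
  · obtain ⟨C₁, hC₁, hlow⟩ := TrigApprox.exists_le_bestMTermClass hk hp hθ hr0
      (show γ ≤ r by linarith)
    obtain ⟨C₂, hC₂, hup⟩ := TrigApprox.exists_bestMTerm_le hC hκ0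
    refine ⟨C₁, C₂, hC₁, hC₂, fun m hm => ⟨hlow m hm, iSup₂_le fun f hf => ?_⟩⟩
    have hexp : -r + γ = -(κ + 1 / 2) := by rw [hκ]; ring
    rw [hexp]
    exact hup f (TrigApprox.integrable_of_inLp hp hf.1) (hblock f hf) m hm
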